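/- Let $\mathcal S$ be a commutative semigroup, written additively. Let $\mathcal S^0=\mathcal S$ if $\mathcal S$ has an identity element $0$, let $\mathcal S^0=\mathcal S\cup\{0\}$ with a new identity $0$ otherwise, and put $\mathcal S^\bullet=\mathcal S^0\setminus\{0\}$. A sequence $T$ over $\mathcal S$ is a finite multiset of elements of $\mathcal S$; $|T|$ is its length and $\sigma(T)\in\mathcal S^0$ the sum of its terms, with $\sigma(\emptyset)=0$. $T$ is irreducible if no proper subsequence $T'$ of $T$ (the empty one included) has $\sigma(T')=\sigma(T)$. For $a\in\mathcal S^\bullet$ let - $\mathrm D_a(\mathcal S)\in\mathbb N\cup\{\infty\}$ be the largest length of an irreducible sequence $T$ over $\mathcal S$ with $\sigma(T)=a$; - $(a)=\{a+c: c\in\mathcal S^0\}$, let $a\,\mathcal H\,b$ mean $(a)=(b)$, and let $H_a$ be the $\mathcal H$-class of $a$; - $\Psi(a)\in\mathbb N_0\cup\{\infty\}$ be the largest $\ell$ for which there are $a_1,\dots,a_\ell\in\mathcal S^0$ with $(a)\subsetneq(a_1)\subsetneq\cdots\subsetneq(a_\ell)$; - $\Gamma(H_a)$ be the Schützenberger group,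 that is, the abelian group (under composition) of all maps $\gamma_c:H_a\to H_a$, $x\mapsto c+x$, where $c\in\mathcal S^0$ satisfies $c+H_a\subseteq H_a$; - $\epsilon=\frac12$ if $(a+a)\,\mathcal H\,a$, and $\epsilon=1$ otherwise. For an abelian group $G$ let $\mathrm D(G)$ be the Davenport constant: the smallest $\ell\in\mathbb N\cup\{\infty\}$ such that every sequence over $G$ of length at least $\ell$ has a nonempty subsequence with sum $0$. **Theorem.** Let $\mathcal S$ be a commutative semigroup and $a\in\mathcal S^\bullet$ with $\Psi(a)$ finite. If $H_a$ is infinite, then $\mathrm D_a(\mathcal S)$ is infinite. If $H_a$ is finite, then $\mathrm D_a(\mathcal S)$ is finite and $$\epsilon\,\mathrm D(\Gamma(H_a))\le \mathrm D_a(\mathcal S)\le \Psi(a)+\mathrm D(\Gamma(H_a))-1 .$$ Both bounds are sharp, as the following cases show; in each of them $a\in\mathcal S^\bullet$, $\Psi(a)$ is finite and $H_a$ is finite. 1. Let $n\ge 2$ be even, $1\le k\le r$, let $\mathcal S$ be the commutative semigroup with generators $x_1,\dots,x_r$ and relations $(n+1)x_i=x_i$ for all $i$ and $x_i+x_j=x_j$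 for $i<j$, and let $a=\frac n2x_k$. Then $(a+a)\,\mathcal H\,a$, $\mathrm D(\Gamma(H_a))=n$ and $\mathrm D_a(\mathcal S)=\frac12\mathrm D(\Gamma(H_a))$. 2. Let $m>2$, let $\mathcal S$ be the commutative semigroup with a zero element $\infty$ generated by $x_0,x_1,\dots,x_m$ with the relations $(m+1)x_0=x_0$, $x_i+x_j=\infty$ for $i,j\in[1,m]$, $x_0+x_k=x_{k+1}$ for $k\in[1,m-1]$ and $x_0+x_m=x_1$, and let $a=x_m$. Then $(a+a)\,\mathcal H\,a$ does not hold, $\mathrm D(\Gamma(H_a))=m$ and $\mathrm D_a(\mathcal S)=\mathrm D(\Gamma(H_a))$. 3. Let $R$ be a finite commutative principal ideal ring with $1$, let $\mathcal S$ be its multiplicative semigroup and $a\in R$ a non-unit. Then $\mathrm D_a(\mathcal S)=\Psi(a)+\mathrm D(\Gamma(H_a))-1$. -/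

import Mathlib

open scoped ENNReal

namespace RelDavenport

/-! ### The monoid `S⁰` obtained by adjoining an identity only when necessary -/

section AdjoinZero

variable (S : Type*) [AddCommSemigroup S]

/-- The congruence on `S ∪ {0}` (a new identity `0` is always adjoined first) which identifies the
new `0` with the identity element of `S` if there is one, and identifies nothing else. -/
def zeroCon : AddCon (WithZero S) where
  r x y := x = y ∨ ((∀ s : S, x + (s : WithZero S) = s) ∧ (∀ s : S, y + (s : WithZero S) = s))
  iseqv :=
    { refl := fun _ => Or.inl rfl
      symm := by
        rintro x y (h | ⟨h₁, h₂⟩)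
        · exact Or.inl h.symm
        · exact Or.inr ⟨h₂, h₁⟩
      trans := by
        rintro x y z (h | ⟨h₁, h₂⟩) (k | ⟨k₁, k₂⟩)
        · exact Or.inl (h.trans k)
        · subst h; exact Or.inr ⟨k₁, k₂⟩
        · subst k; exact Or.inr ⟨h₁, h₂⟩
        · exact Or.inr ⟨h₁, k₂⟩ }
  add' := by
    have key : ∀ x y z : WithZero S, (∀ s : S, x + (s : WithZero S) = s) →
        (∀ s : S, y + (s : WithZero S) = s) →
        (x + z = y + z ∨
          ((∀ s : S, x + z + (s : WithZero S) = s) ∧ (∀ s : S, y + z + (s : WithZero S) = s))) := by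
      intro x y z hx hy
      induction z with
      | zero => right; simpa using ⟨hx, hy⟩
      | coe t => left; rw [hx, hy]
    rintro w x y z (h | ⟨h₁, h₂⟩) (k | ⟨k₁, k₂⟩)
    · left; rw [h, k]
    · subst h
      rw [add_comm w y, add_comm w z]
      exact key y z w k₁ k₂
    · subst k
      exact key w x y h₁ h₂
    · right
      constructor
      · intro s; rw [add_assoc, k₁, h₁]
      · intro s; rw [add_assoc, k₂, h₂]

/-- `S⁰`: the semigroup `S` itself if it has an identity element, and `S ∪ {0}` otherwise. -/
abbrev AdjoinZero : Type _ := (zeroCon S).Quotient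

end AdjoinZero

section Sequences

variable {S : Type*} [AddCommSemigroup S]

/-- The inclusion of `S` in `S⁰`. -/
def incl (s : S) : AdjoinZero S := ((s : WithZero S) : (zeroCon S).Quotient)

theorem incl_add (s t : S) : incl (s + t) = incl s + incl t := rfl

theorem incl_injective : Function.Injective (incl (S := S)) := by
  intro s t h
  rcases (zeroCon S).eq.1 h with h | ⟨h₁, h₂⟩
  · exact WithZero.coe_inj.1 h
  · have e₁ : s + t = t := WithZero.coe_inj.1 (h₁ t)
    have e₂ : t + s = s := WithZero.coe_inj.1 (h₂ s)
    rw [← e₂, add_comm, e₁]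

theorem incl_eq_zero_iff (e : S) : incl e = 0 ↔ ∀ s : S, e + s = s := by
  constructor
  · intro h s
    apply incl_injective
    rw [incl_add, h, zero_add]
  · intro h
    refine (zeroCon S).eq.2 (Or.inr ⟨fun s => ?_, fun s => zero_add _⟩)
    exact WithZero.coe_inj.2 (h s)

theorem eq_zero_or_incl (x : AdjoinZero S) : x = 0 ∨ ∃ s : S, x = incl s := by
  induction x using AddCon.induction_on with
  | H x =>
    induction x with
    | zero => exact Or.inl rfl
    | coe s => exact Or.inr ⟨s, rfl⟩

/-- Sequences over `S` are multisets; `σ(T)` is the sum of all terms, and the empty sequence has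
sum `0`. -/
def seqSum (T : Multiset S) : AdjoinZero S := (T.map incl).sum

/-- A sequence is reducible if some proper subsequence has the same sum. -/
def Reducible (T : Multiset S) : Prop := ∃ T' : Multiset S, T' < T ∧ seqSum T' = seqSum T

/-- `D_a(S)`: the largest length, in `ℕ ∪ {∞}`, of an irreducible sequence over `S` with sum `a`. -/
noncomputable def relDavenport (a : AdjoinZero S) : ℕ∞ :=
  ⨆ (T : Multiset S) (_ : ¬ Reducible T ∧ seqSum T = a), (T.card : ℕ∞)

end Sequences

/-- `D(G)` for an abelian group `G`: the smallest `ℓ ∈ ℕ ∪ {∞}` such that every sequence over `G`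
of length at least `ℓ` has a nonempty zero-sum subsequence. -/
noncomputable def davenport (G : Type*) [AddCommGroup G] : ℕ∞ :=
  sInf {l : ℕ∞ | ∀ T : Multiset G, l ≤ (T.card : ℕ∞) → ∃ T' ≤ T, T' ≠ 0 ∧ T'.sum = 0}

/-! ### Green's relation, chains of principal ideals and the Schützenberger group

These are stated for a commutative monoid and will be used for the monoid `S⁰`. If `S` has no
identity then `0` is alone in its class, so that for `a ∈ S` the class of `a` in `S⁰` is
its class in `S`. -/

section Green

variable {M : Type*} [AddCommMonoid M]

/-- The principal ideal `(a) = {a + c}`. -/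
def principalIdeal (a : M) : Set M := {x | ∃ c : M, x = a + c}

/-- Green's relation: `a` and `b` generate the same principal ideal. -/
def GreenH (a b : M) : Prop := principalIdeal a = principalIdeal b

/-- The class `H_a`. -/
def hClass (a : M) : Set M := {x | GreenH x a}

/-- `Ψ(a)`: the largest `ℓ ∈ ℕ ∪ {∞}` with a chain `(a) ⊊ (a₁) ⊊ ⋯ ⊊ (a_ℓ)`. -/
noncomputable def chainLength (a : M) : ℕ∞ :=
  ⨆ (l : ℕ) (_ : ∃ f : Fin (l + 1) → M, f 0 = a ∧
      ∀ i : Fin l, principalIdeal (f i.castSucc) ⊂ principalIdeal (f i.succ)), (l : ℕ∞)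

open Classical in
/-- `ε = 1/2` if `a + a` and `a` are `𝓗`-related, and `ε = 1` otherwise. -/
noncomputable def epsilon (a : M) : ℝ≥0∞ := if GreenH (a + a) a then 1 / 2 else 1

/-- The stabilizer `St(A)`. -/
def stabilizer (A : Set M) : Set M := {c | ∀ x ∈ A, c + x ∈ A}

/-- The map `γ_c : H_a → H_a`, `x ↦ c + x`, for `c ∈ St(H_a)`. -/
def gammaMap (a : M) (c : stabilizer (hClass a)) (x : hClass a) : hClass a :=
  ⟨c + x, c.2 x x.2⟩

/-- The Schützenberger group `Γ(H_a) = {γ_c : c ∈ St(H_a)}`, a set of maps `H_a → H_a`. -/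
def Schutzenberger (a : M) : Type _ :=
  {f : hClass a → hClass a // ∃ c : stabilizer (hClass a), f = gammaMap a c}

theorem mem_hClass_iff {a x : M} : x ∈ hClass a ↔ (∃ c, a = x + c) ∧ ∃ c, x = a + c := by
  constructor
  · intro h
    have h' : principalIdeal x = principalIdeal a := h
    constructor
    · have : a ∈ principalIdeal a := ⟨0, by simp⟩
      rwa [← h'] at this
    · have : x ∈ principalIdeal x := ⟨0, by simp⟩
      rwa [h'] at this
  · rintro ⟨⟨c, hc⟩, d, hd⟩
    apply Set.Subset.antisymm
    · rintro _ ⟨e, rfl⟩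
      exact ⟨d + e, by rw [← add_assoc, ← hd]⟩
    · rintro _ ⟨e, rfl⟩
      exact ⟨c + e, by rw [← add_assoc, ← hc]⟩

/-- An element that fixes `a` fixes every element of `H_a`. -/
theorem fix_hClass {a e : M} (h : e + a = a) {x : M} (hx : x ∈ hClass a) : e + x = x := by
  obtain ⟨-, c, rfl⟩ := mem_hClass_iff.1 hx
  rw [← add_assoc, h]

theorem mem_stabilizer_of_add_mem {a c : M} (h : c + a ∈ hClass a) :
    c ∈ stabilizer (hClass a) := by
  intro x hx
  obtain ⟨⟨d, hd⟩, -⟩ := mem_hClass_iff.1 h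
  have h1 := mem_hClass_iff.1 hx
  obtain ⟨⟨p, hp⟩, q, hq⟩ := h1
  obtain ⟨-, r, hr⟩ := mem_hClass_iff.1 h
  refine mem_hClass_iff.2 ⟨⟨p + d, ?_⟩, r + q, ?_⟩
  · calc a = c + a + d := hd
      _ = c + (x + p) + d := by rw [← hp]
      _ = c + x + (p + d) := by abel
  · calc c + x = c + (a + q) := by rw [← hq]
      _ = (c + a) + q := by abel
      _ = a + r + q := by rw [← hr]
      _ = a + (r + q) := by abel

theorem exists_neg_stabilizer (a : M) (c : stabilizer (hClass a)) :
    ∃ d : stabilizer (hClass a), ∀ x ∈ hClass a, (d : M) + (c + x) = x := by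
  have ha : a ∈ hClass a := rfl
  obtain ⟨⟨d, hd⟩, -⟩ := mem_hClass_iff.1 (c.2 a ha)
  have hda : d + (c : M) + a = a := by
    conv_rhs => rw [hd]
    abel
  have hds : d ∈ stabilizer (hClass a) := by
    apply mem_stabilizer_of_add_mem
    refine mem_hClass_iff.2 ⟨⟨c, ?_⟩, d, add_comm _ _⟩
    conv_lhs => rw [hd]
    abel
  refine ⟨⟨d, hds⟩, fun x hx => ?_⟩
  rw [← add_assoc]
  exact fix_hClass hda hx

theorem exists_neg_schutzenberger (a : M) (f : Schutzenberger a) :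
    ∃ g : Schutzenberger a, g.1 ∘ f.1 = id := by
  obtain ⟨f, c, rfl⟩ := f
  obtain ⟨d, hd⟩ := exists_neg_stabilizer a c
  exact ⟨⟨gammaMap a d, d, rfl⟩, funext fun x => Subtype.ext (hd x x.2)⟩

/-- The group operation of `Γ(H_a)` is composition of maps, that is `γ_c + γ_d = γ_{c + d}`. -/
instance (a : M) : Add (Schutzenberger a) where
  add f g := ⟨f.1 ∘ g.1, by
    obtain ⟨f, c, rfl⟩ := f
    obtain ⟨g, d, rfl⟩ := g
    refine ⟨⟨c + d, fun x hx => ?_⟩, funext fun x => Subtype.ext (add_assoc _ _ _).symm⟩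
    rw [add_assoc]
    exact c.2 _ (d.2 x hx)⟩

instance (a : M) : Zero (Schutzenberger a) where
  zero := ⟨id, ⟨0, fun x hx => by simpa using hx⟩, funext fun x => Subtype.ext (zero_add _).symm⟩

noncomputable instance (a : M) : Neg (Schutzenberger a) where
  neg f := (exists_neg_schutzenberger a f).choose

noncomputable instance (a : M) : AddCommGroup (Schutzenberger a) where
  add_assoc _ _ _ := rfl
  zero_add _ := rfl
  add_zero _ := rfl
  neg_add_cancel f := Subtype.ext (exists_neg_schutzenberger a f).choose_spec
  add_comm := by
    rintro ⟨f, c, rfl⟩ ⟨g, d, rfl⟩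
    exact Subtype.ext (funext fun x => Subtype.ext (add_left_comm _ _ _))
  nsmul := nsmulRec
  zsmul := zsmulRec

end Green

/-! ### Commutative semigroups given by generators and relations -/

section Presented

/-- The free commutative semigroup on `X`: nonempty multisets. -/
def FreeCommSemigroup (X : Type*) : Type _ := {m : Multiset X // m ≠ 0}

instance (X : Type*) : AddCommSemigroup (FreeCommSemigroup X) where
  add u v := ⟨u.1 + v.1, fun h => u.2 (by simpa using (add_eq_zero.1 h).1)⟩
  add_assoc u v w := Subtype.ext (add_assoc u.1 v.1 w.1)
  add_comm u v := Subtype.ext (add_comm u.1 v.1)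

/-- The commutative semigroup `⟨X | r⟩`; a word in the generators is a nonempty multiset. -/
abbrev Presented {X : Type*} (r : Multiset X → Multiset X → Prop) : Type _ :=
  (addConGen (fun u v : FreeCommSemigroup X => r u.1 v.1)).Quotient

/-- The class of a generator. -/
def gen {X : Type*} (r : Multiset X → Multiset X → Prop) (x : X) : Presented r :=
  AddCon.toQuotient (c := addConGen (fun u v : FreeCommSemigroup X => r u.1 v.1))
    ⟨{x}, by simp⟩

/-- The relations `(n + 1) x_i = x_i`, and `x_i + x_j = x_j` for `i < j`. -/
inductive ChainRel (n r : ℕ) : Multiset (Fin r) → Multiset (Fin r) → Prop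
  | period (i : Fin r) : ChainRel n r ((n + 1) • {i}) {i}
  | absorb (i j : Fin r) (h : i < j) : ChainRel n r ({i} + {j}) {j}

/-- The generators `x_0`, `x_k` with `k` modulo `m`, and `∞`. -/
inductive TorsorGen (m : ℕ) : Type
  | base : TorsorGen m
  | point (k : ZMod m) : TorsorGen m
  | infty : TorsorGen m

/-- The relations `(m + 1) x_0 = x_0`, `x_i + x_j = ∞` and `x_0 + x_k = x_{k + 1}` for indices
modulo `m`, together with those that make `∞` a zero element. -/
inductive TorsorRel (m : ℕ) : Multiset (TorsorGen m) → Multiset (TorsorGen m) → Prop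
  | period : TorsorRel m ((m + 1) • {.base}) {.base}
  | shift (k : ZMod m) : TorsorRel m ({.base} + {.point k}) {.point (k + 1)}
  | collapse (i j : ZMod m) : TorsorRel m ({.point i} + {.point j}) {.infty}
  | infty (y : TorsorGen m) : TorsorRel m ({.infty} + {y}) {.infty}

end Presented

end RelDavenport

open RelDavenport

/-! Everything takes place in `S⁰`. The stabilizer of H_a maps onto Γ(H_a), and evaluation at a
identifies Γ(H_a) with H_a (`schutzenbergerEquiv`). Since D(G) is at most |G| for finite G and
infinite for infinite G, D(Γ(H_a)) is finite exactly when H_a is.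

Upper bound (`IrreducibleSeq.card_add_one_le`): in an irreducible T with sum a, take a minimal A ≤ T
with sum in H_a. Its prefix sums generate strictly decreasing ideals, so |A| ≤ Ψ(a). The remaining
terms stabilize H_a, and their images in Γ(H_a) form a zero-sum free sequence, because terms acting
trivially could be dropped; so at most D(Γ(H_a)) - 1 of them remain.

Lower bound: lift a long zero-sum free sequence C from Γ(H_a) to the stabilizer. If a + a is not in
H_a, one extra term in H_a brings the sum to a (`exists_irreducibleSeq_of_not_greenH`). Otherwise
H_a is a group isomorphic to Γ(H_a), and the question becomes one about representing a group element
x irreducibly; half the length can always be reached (`ZeroSumFree.exists_irreducible`). The lower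
bound also yields the infinite case.

Sharpness: the presented semigroups are separated by homomorphisms to ℤ/n ∪ {⊤} and to dual numbers
over ℤ[ℤ/m]. In the chain example, reduction modulo n/2 bounds irreducible sequences by n/2; in the
torsor example Ψ(a) ≤ 1, so the two general bounds meet. For a finite principal ideal ring, a
shortest factorization into generators of maximal ideals has length at least Ψ(a), and D(Γ(H_a)) - 1
units can be appended to it because every element of Γ(H_a) is induced by a unit. -/

namespace RelDavenport

/-! ### Subsequences of sums and images of multisets. -/

section Multisets

variable {α β : Type*}

theorem le_cons_cases {g : α} {T' T : Multiset α} (h : T' ≤ g ::ₘ T) :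
    T' ≤ T ∨ ∃ U ≤ T, T' = g ::ₘ U := by
  by_cases hg : g ∈ T'
  · obtain ⟨U, rfl⟩ := Multiset.exists_cons_of_mem hg
    exact Or.inr ⟨U, (Multiset.cons_le_cons_iff g).1 h, rfl⟩
  · exact Or.inl ((Multiset.le_cons_of_notMem hg).1 h)

theorem exists_eq_add_of_le_add {T A B : Multiset α} (h : T ≤ A + B) :
    ∃ A' ≤ A, ∃ B' ≤ B, T = A' + B' := by
  classical
  refine ⟨T ∩ A, Multiset.inter_le_right, T - A, ?_, ?_⟩
  · rw [tsub_le_iff_left]; exact h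
  · ext x
    simp only [Multiset.count_add, Multiset.count_inter, Multiset.count_sub]
    omega

theorem exists_map_eq_of_le_map {f : α → β} {T : Multiset α} {T' : Multiset β}
    (h : T' ≤ T.map f) : ∃ U ≤ T, U.map f = T' := by
  classical
  induction T using Multiset.induction generalizing T' with
  | empty => exact ⟨0, le_rfl, by simpa using h.antisymm (Multiset.zero_le _) |>.symm⟩
  | cons x T ih =>
    rw [Multiset.map_cons] at h
    rcases le_cons_cases h with h | ⟨V, hV, rfl⟩
    · obtain ⟨U, hU, rfl⟩ := ih h
      exact ⟨U, hU.trans (Multiset.le_cons_self _ _), rfl⟩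
    · obtain ⟨U, hU, rfl⟩ := ih hV
      exact ⟨x ::ₘ U, (Multiset.cons_le_cons_iff x).2 hU, by simp⟩

theorem exists_le_card_eq_of_le_card {T : Multiset α} {n : ℕ} (h : n ≤ T.card) :
    ∃ U ≤ T, U.card = n := by
  induction T using Quotient.inductionOn with
  | h l => exact ⟨(l.take n : List α), (List.take_sublist n l).subperm, by simpa using h⟩

theorem exists_map_eq_of_lt_map {f : α → β} {T : Multiset α} {T' : Multiset β}
    (h : T' < T.map f) : ∃ U < T, U.map f = T' := by
  obtain ⟨U, hU, rfl⟩ := exists_map_eq_of_le_map h.le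
  exact ⟨U, lt_of_le_of_ne hU (by rintro rfl; exact lt_irrefl _ h), rfl⟩

end Multisets

/-! ### Zero-sum free sequences and the Davenport constant of a group -/

section ZeroSumFree

variable {G : Type*} [AddCommGroup G]

/-- A sequence over an abelian group is zero-sum free if no nonempty subsequence has sum `0`. -/
def ZeroSumFree (T : Multiset G) : Prop := ∀ T' ≤ T, T' ≠ 0 → T'.sum ≠ 0

theorem ZeroSumFree.mono {T U : Multiset G} (hT : ZeroSumFree T) (h : U ≤ T) : ZeroSumFree U :=
  fun T' hT' => hT T' (hT'.trans h)

theorem ZeroSumFree.sum_ne {T U : Multiset G} (hT : ZeroSumFree T) (h : U < T) :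
    U.sum ≠ T.sum := by
  obtain ⟨V, rfl⟩ := Multiset.le_iff_exists_add.1 h.le
  intro e
  rw [Multiset.sum_add, left_eq_add] at e
  refine hT V (Multiset.le_add_left _ _) ?_ e
  rintro rfl
  simp at h

theorem ZeroSumFree.card_add_one_le {T : Multiset G} (hT : ZeroSumFree T) :
    (T.card : ℕ∞) + 1 ≤ davenport G := by
  refine le_sInf fun l hl => ?_
  by_contra h
  rw [ENat.add_one_le_iff (ENat.natCast_ne_top _), not_lt] at h
  obtain ⟨T', h1, h2, h3⟩ := hl T h
  exact hT T' h1 h2 h3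

theorem exists_zeroSumFree {n : ℕ} (h : (n : ℕ∞) < davenport G) :
    ∃ T : Multiset G, ZeroSumFree T ∧ T.card = n := by
  have h' : (n : ℕ∞) ∉ {l : ℕ∞ | ∀ T : Multiset G, l ≤ (T.card : ℕ∞) →
      ∃ T' ≤ T, T' ≠ 0 ∧ T'.sum = 0} := notMem_of_lt_csInf h (OrderBot.bddBelow _)
  simp only [Set.mem_ofPred_eq, not_forall] at h'
  obtain ⟨T, hn, hT⟩ := h'
  obtain ⟨U, hU, hc⟩ := exists_le_card_eq_of_le_card (Nat.cast_le.1 hn)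
  exact ⟨U, fun T' h1 h2 h3 => hT ⟨T', h1.trans hU, h2, h3⟩, hc⟩

/-- Pigeonhole on prefix sums: a list of length at least |G| has more prefixes than there are group
elements, and the block between two prefixes of equal sum has sum zero. -/
theorem davenport_le_card (G : Type*) [AddCommGroup G] [Finite G] :
    davenport G ≤ Nat.card G := by
  refine sInf_le fun T hT => ?_
  have hT : Nat.card G ≤ T.card := Nat.cast_le.1 hT
  induction T using Quotient.inductionOn with
  | h l =>
    have hl : Nat.card G ≤ l.length := hT
    obtain ⟨i, j, hij, e⟩ : ∃ i j : Fin (l.length + 1), i < j ∧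
        (l.take i).sum = (l.take j).sum := by
      have : ¬ Function.Injective (fun i : Fin (l.length + 1) => (l.take i).sum) := by
        intro hi
        have := Nat.card_le_card_of_injective _ hi
        simp at this
        omega
      simp only [Function.Injective, not_forall] at this
      obtain ⟨i, j, e, hne⟩ := this
      rcases lt_or_gt_of_ne hne with h | h
      · exact ⟨i, j, h, e⟩
      · exact ⟨j, i, h, e.symm⟩
    have hij' : (i : ℕ) < j := hij
    have hj := j.2
    refine ⟨((l.drop i).take (j - i) : List G),
      ((List.take_sublist _ _).trans (List.drop_sublist _ _)).subperm, ?_, ?_⟩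
    · intro h
      have := congrArg Multiset.card h
      simp at this
      omega
    · have h2 : (l.take i).sum + ((l.drop i).take (j - i)).sum = (l.take j).sum := by
        rw [← List.sum_append]
        congr 1
        have := List.take_add (l := l) (i := i) (j := j - i)
        rw [← this]
        congr 1
        omega
      rw [← e] at h2
      simpa using h2

theorem ZeroSumFree.cons {T : Multiset G} (hT : ZeroSumFree T) {g : G}
    (hg : ∀ U ≤ T, g + U.sum ≠ 0) : ZeroSumFree (g ::ₘ T) := by
  intro T' h1 h2
  rcases le_cons_cases h1 with h | ⟨U, hU, rfl⟩
  · exact hT T' h h2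
  · rw [Multiset.sum_cons]
    exact hg U hU

/-- Greedy construction: a zero-sum free sequence can be extended by any element outside the finite
set of negatives of its subsums. -/
theorem davenport_eq_top (G : Type*) [AddCommGroup G] [Infinite G] : davenport G = ⊤ := by
  have key : ∀ n : ℕ, ∃ T : Multiset G, ZeroSumFree T ∧ T.card = n := by
    intro n
    induction n with
    | zero => exact ⟨0, fun T' h1 h2 => absurd (le_bot_iff.1 h1) h2, rfl⟩
    | succ n ih =>
      classical
      obtain ⟨T, hT, hc⟩ := ih
      obtain ⟨g, hg⟩ := Infinite.exists_notMem_finset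
        ((T.powerset.map (fun U => -U.sum)).toFinset)
      refine ⟨g ::ₘ T, hT.cons fun U hU e => hg ?_, by simp [hc]⟩
      simp only [Multiset.mem_toFinset, Multiset.mem_map, Multiset.mem_powerset]
      exact ⟨U, hU, (eq_neg_of_add_eq_zero_left e).symm⟩
  refine ENat.eq_top_iff_forall_ge.2 fun n => ?_
  obtain ⟨T, hT, rfl⟩ := key n
  exact le_self_add.trans hT.card_add_one_le

/-- The extremal zero-sum free sequence is the generator repeated ord(g) - 1 times. -/
theorem davenport_eq_addOrderOf [Finite G] {g : G} (hg : ∀ x : G, ∃ j : ℕ, x = j • g) :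
    davenport G = addOrderOf g := by
  have htop : AddSubgroup.zmultiples g = ⊤ := by
    refine eq_top_iff.2 fun x _ => ?_
    obtain ⟨j, rfl⟩ := hg x
    exact AddSubgroup.nsmul_mem_zmultiples g j
  have hcard : Nat.card G = addOrderOf g := by
    rw [← Nat.card_zmultiples, htop]
    simp
  refine le_antisymm (hcard ▸ davenport_le_card G) ?_
  have hpos : 0 < addOrderOf g := addOrderOf_pos g
  have hT : ZeroSumFree (Multiset.replicate (addOrderOf g - 1) g) := by
    intro T' h1 h2 h3
    obtain ⟨j, hj, rfl⟩ := Multiset.le_replicate_iff.1 h1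
    rw [Multiset.sum_replicate] at h3
    have := Nat.le_of_dvd (Nat.pos_of_ne_zero (by rintro rfl; simp at h2))
      (addOrderOf_dvd_of_nsmul_eq_zero h3)
    omega
  have := hT.card_add_one_le
  rw [Multiset.card_replicate] at this
  rwa [← Nat.cast_add_one, Nat.sub_add_cancel hpos] at this

/-- If there is a zero-sum free sequence of length `n`, then every `x` is the sum of a nonempty
sequence of length at least `(n + 1) / 2` no proper nonempty subsequence of which has sum `x`. -/
theorem ZeroSumFree.exists_irreducible {T : Multiset G} (hT : ZeroSumFree T) (x : G) :
    ∃ U : Multiset G, U ≠ 0 ∧ U.sum = x ∧ (∀ U' < U, U' ≠ 0 → U'.sum ≠ x) ∧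
      T.card + 1 ≤ 2 * U.card := by
  by_cases hx : ∃ A ≤ T, A.sum = x
  · obtain ⟨A, hA, rfl⟩ := hx
    obtain ⟨B, rfl⟩ := Multiset.le_iff_exists_add.1 hA
    rcases le_total (B.card + 1) A.card with h | h
    · refine ⟨A, by rintro rfl; simp at h, rfl, fun U' h1 _ => (hT.mono hA).sum_ne h1, ?_⟩
      rw [Multiset.card_add]
      omega
    -- When A is short, use its complement: σ(T) together with the negatives of B has sum σ(A) = x
    -- and length |B| + 1. A proper nonempty part with sum x would give a zero sum in A + B, or a
    -- proper part of B with the sum of B.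
    · set s := (A + B).sum with hs
      refine ⟨(-s ::ₘ B).map (fun y => -y), by simp, ?_, ?_, ?_⟩
      · rw [Multiset.sum_map_neg, Multiset.map_id', Multiset.sum_cons, hs, Multiset.sum_add]
        abel
      · intro U' h1 h2 h3
        obtain ⟨V, hV, rfl⟩ := exists_map_eq_of_lt_map h1
        rw [Multiset.sum_map_neg, Multiset.map_id'] at h3
        rcases le_cons_cases hV.le with h | ⟨W, hW, rfl⟩
        · refine hT (A + V) (add_le_add_right h A) (by rintro e; simp_all) ?_
          rw [Multiset.sum_add, ← h3]
          abel
        · have hW' : W < B := (Multiset.cons_lt_cons_iff).1 hV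
          refine (hT.mono (Multiset.le_add_left B A)).sum_ne hW' ?_
          rw [Multiset.sum_cons, hs, Multiset.sum_add] at h3
          have : W.sum - B.sum = 0 := by
            calc W.sum - B.sum = A.sum - -(-(A.sum + B.sum) + W.sum) := by abel
              _ = 0 := by rw [h3]; abel
          exact sub_eq_zero.1 this
      · simp only [Multiset.card_add, Multiset.card_map, Multiset.card_cons]
        omega
  · have hx' : ∀ A ≤ T, A.sum ≠ x := by simpa using hx
    -- A zero sum x - σ(T) + σ(U) = 0 would make x the sum of the complement of U, against the
    -- assumption that x is no subsum.
    have hz : ZeroSumFree ((x - T.sum) ::ₘ T) := by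
      refine hT.cons fun U hU e => ?_
      obtain ⟨V, rfl⟩ := Multiset.le_iff_exists_add.1 hU
      refine hx' V (Multiset.le_add_left _ _) ?_
      rw [Multiset.sum_add] at e
      have : V.sum - x = 0 := by
        calc V.sum - x = -(x - (U.sum + V.sum) + U.sum) := by abel
          _ = 0 := by rw [e, neg_zero]
      exact sub_eq_zero.1 this
    refine ⟨(x - T.sum) ::ₘ T, by simp, by simp, fun U' h1 _ => ?_, ?_⟩
    · have := hz.sum_ne h1
      simpa using this
    · rw [Multiset.card_cons]
      omega

end ZeroSumFree

/-! ### Irreducible sequences over a commutative monoid -/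

section Irreducible

/-- A sequence over a monoid is irreducible if no proper subsequence has the same sum. -/
def IrreducibleSeq {M : Type*} [AddCommMonoid M] (T : Multiset M) : Prop :=
  ∀ T' < T, T'.sum ≠ T.sum

theorem IrreducibleSeq.zero_notMem {M : Type*} [AddCommMonoid M] {T : Multiset M}
    (hT : IrreducibleSeq T) : (0 : M) ∉ T := by
  intro h
  obtain ⟨U, rfl⟩ := Multiset.exists_cons_of_mem h
  exact hT U (Multiset.lt_cons_self _ _) (by simp)

variable {S : Type*} [AddCommSemigroup S] {a : AdjoinZero S}

/-- An irreducible sequence has no term 0, so all its terms come from S even when 0 is a new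
element; hence one may work with sequences over `S⁰`. -/
theorem le_relDavenport {T : Multiset (AdjoinZero S)} (hT : IrreducibleSeq T) (ha : T.sum = a) :
    (T.card : ℕ∞) ≤ relDavenport a := by
  have hlift : ∀ x ∈ T, ∃ s : S, incl s = x := by
    intro x hx
    rcases eq_zero_or_incl x with rfl | ⟨s, rfl⟩
    · exact absurd hx hT.zero_notMem
    · exact ⟨s, rfl⟩
  have : CanLift (AdjoinZero S) S incl (fun x => ∃ s : S, incl s = x) := ⟨fun _ h => h⟩
  lift T to Multiset S using hlift
  rw [Multiset.card_map]
  refine le_iSup₂_of_le T ⟨?_, ha⟩ le_rfl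
  rintro ⟨T', h1, h2⟩
  exact hT _ (Multiset.map_strictMono _ h1) h2

theorem relDavenport_le {n : ℕ∞} (h : ∀ T : Multiset (AdjoinZero S), IrreducibleSeq T →
    T.sum = a → (T.card : ℕ∞) ≤ n) : relDavenport a ≤ n := by
  refine iSup₂_le fun T hT => ?_
  have := h (T.map incl) ?_ hT.2
  · simpa using this
  · intro T' h1 h2
    obtain ⟨U, hU, rfl⟩ := exists_map_eq_of_lt_map h1
    exact hT.1 ⟨U, hU, h2⟩

end Irreducible

/-! ### The Schützenberger group -/

section SchutzenbergerGroup

variable {M : Type*} [AddCommMonoid M]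

theorem mem_hClass_self (a : M) : a ∈ hClass a := rfl

/-- Compatibility with addition is what allows a term that does not change the ideal of a prefix sum
to be deleted from the whole sequence. -/
theorem greenH_add_right {a b : M} (h : GreenH a b) (c : M) : GreenH (a + c) (b + c) := by
  obtain ⟨⟨d, hd⟩, e, he⟩ := mem_hClass_iff.1 (show a ∈ hClass b from h)
  refine mem_hClass_iff.2 ⟨⟨d, ?_⟩, e, ?_⟩
  · conv_lhs => rw [hd]
    abel
  · conv_lhs => rw [he]
    abel

/-- The stabilizer of `H_a` as a submonoid. -/
def stabMonoid (a : M) : AddSubmonoid M where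
  carrier := stabilizer (hClass a)
  zero_mem' := fun x hx => by simpa using hx
  add_mem' := fun {c d} hc hd x hx => by
    rw [add_assoc]
    exact hc _ (hd x hx)

theorem mem_stabMonoid {a c : M} : c ∈ stabMonoid a ↔ c + a ∈ hClass a :=
  ⟨fun h => h a (mem_hClass_self a), mem_stabilizer_of_add_mem⟩

theorem mem_stabMonoid_of_eq_add {a c d : M} (h : a = c + a + d) : c ∈ stabMonoid a :=
  mem_stabMonoid.2 (mem_hClass_iff.2 ⟨⟨d, h⟩, c, add_comm _ _⟩)

/-- The homomorphism `c ↦ γ_c` from the stabilizer onto the Schützenberger group. -/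
def gammaHom (a : M) : stabMonoid a →+ Schutzenberger a where
  toFun c := ⟨gammaMap a c, c, rfl⟩
  map_zero' := Subtype.ext (funext fun _ => Subtype.ext (zero_add _))
  map_add' _ _ := Subtype.ext (funext fun _ => Subtype.ext (add_assoc _ _ _))

theorem gammaHom_surjective (a : M) : Function.Surjective (gammaHom a) := by
  rintro ⟨_, c, rfl⟩
  exact ⟨c, rfl⟩

theorem gammaHom_eq_iff {a : M} {c d : stabMonoid a} :
    gammaHom a c = gammaHom a d ↔ (c : M) + a = d + a := by
  constructor
  · intro h
    exact congrArg Subtype.val (congrFun (congrArg Subtype.val h) ⟨a, mem_hClass_self a⟩)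
  · intro h
    refine Subtype.ext (funext fun x => Subtype.ext ?_)
    obtain ⟨x, hx⟩ := x
    obtain ⟨-, e, rfl⟩ := mem_hClass_iff.1 hx
    change (c : M) + (a + e) = d + (a + e)
    rw [← add_assoc, h, add_assoc]

theorem gammaHom_eq_zero_iff {a : M} {c : stabMonoid a} :
    gammaHom a c = 0 ↔ (c : M) + a = a := by
  rw [← map_zero (gammaHom a), gammaHom_eq_iff, AddSubmonoid.coe_zero, zero_add]

/-- Evaluation at `a` is a bijection from the Schützenberger group to `H_a`. -/
noncomputable def schutzenbergerEquiv (a : M) : Schutzenberger a ≃ hClass a :=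
  Equiv.ofBijective (fun f => f.1 ⟨a, mem_hClass_self a⟩) <| by
    constructor
    · intro f g h
      obtain ⟨c, rfl⟩ := gammaHom_surjective a f
      obtain ⟨d, rfl⟩ := gammaHom_surjective a g
      exact gammaHom_eq_iff.2 (congrArg Subtype.val h)
    · rintro ⟨x, hx⟩
      obtain ⟨-, c, rfl⟩ := mem_hClass_iff.1 hx
      have hx' : c + a ∈ hClass a := by rwa [add_comm]
      exact ⟨gammaHom a ⟨c, mem_stabMonoid.2 hx'⟩, Subtype.ext (add_comm _ _)⟩

theorem davenport_schutzenberger_ne_top {a : M} (h : (hClass a).Finite) :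
    davenport (Schutzenberger a) ≠ ⊤ := by
  have : Finite (hClass a) := h
  have : Finite (Schutzenberger a) := Finite.of_equiv _ (schutzenbergerEquiv a).symm
  exact ne_top_of_le_ne_top (ENat.natCast_ne_top _) (davenport_le_card _)

theorem davenport_schutzenberger_eq_top {a : M} (h : (hClass a).Infinite) :
    davenport (Schutzenberger a) = ⊤ := by
  have : Infinite (hClass a) := h.to_subtype
  have : Infinite (Schutzenberger a) := (schutzenbergerEquiv a).infinite_iff.2 this
  exact davenport_eq_top _

/-- A criterion for the Schützenberger group to be cyclic of order `n`, in terms of an element `u`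
that acts as a generator. -/
theorem davenport_schutzenberger_of_generator {a u : M} (hfin : (hClass a).Finite) {n : ℕ}
    (hu : u ∈ stabMonoid a) (hord : ∀ j : ℕ, j • u + a = a ↔ n ∣ j)
    (hgen : ∀ c ∈ stabMonoid a, ∃ j : ℕ, c + a = j • u + a) :
    davenport (Schutzenberger a) = n := by
  have : Finite (hClass a) := hfin
  have : Finite (Schutzenberger a) := Finite.of_equiv _ (schutzenbergerEquiv a).symm
  rw [davenport_eq_addOrderOf (g := gammaHom a ⟨u, hu⟩)]
  · congr 1
    refine Nat.dvd_right_iff_eq.1 fun j => ?_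
    rw [addOrderOf_dvd_iff_nsmul_eq_zero, ← map_nsmul, gammaHom_eq_zero_iff]
    exact hord j
  · intro x
    obtain ⟨c, rfl⟩ := gammaHom_surjective a x
    obtain ⟨j, hj⟩ := hgen c c.2
    refine ⟨j, ?_⟩
    rw [← map_nsmul, gammaHom_eq_iff]
    exact hj

/-- Zero-sum free sequences over the Schützenberger group lift to the stabilizer. -/
theorem exists_lift_zeroSumFree {a : M} {n : ℕ}
    (h : (n : ℕ∞) < davenport (Schutzenberger a)) (P : M → Prop)
    (hP : ∀ c ∈ stabMonoid a, ∃ d, P d ∧ d + a = c + a) :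
    ∃ C : Multiset M, C.card = n ∧ (∀ c ∈ C, P c) ∧ C.sum ∈ stabMonoid a ∧
      ∀ C' ≤ C, C' ≠ 0 → C'.sum + a ≠ a := by
  obtain ⟨T, hT, hc⟩ := exists_zeroSumFree h
  have hs : ∀ x : Schutzenberger a, ∃ c : stabMonoid a, P c ∧ gammaHom a c = x := by
    intro x
    obtain ⟨c, rfl⟩ := gammaHom_surjective a x
    obtain ⟨d, hd, e⟩ := hP c c.2
    have hd' : d ∈ stabMonoid a := mem_stabMonoid.2 (e ▸ mem_stabMonoid.1 c.2)
    exact ⟨⟨d, hd'⟩, hd, gammaHom_eq_iff.2 e⟩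
  choose s hs1 hs2 using hs
  have hsum : ∀ U : Multiset (Schutzenberger a), (U.map fun x => (s x : M)).sum =
      ((U.map s).sum : stabMonoid a) := by
    intro U
    rw [AddSubmonoid.coe_multiset_sum, Multiset.map_map]
    rfl
  refine ⟨T.map fun x => (s x : M), by simpa using hc, ?_, ?_, ?_⟩
  · simpa using fun x _ => hs1 x
  · rw [hsum]
    exact Subtype.prop _
  · intro C' h1 h2 h3
    obtain ⟨U, hU, rfl⟩ := exists_map_eq_of_le_map h1
    refine hT U hU (by simpa using h2) ?_
    rw [hsum, ← gammaHom_eq_zero_iff, map_multiset_sum, Multiset.map_map] at h3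
    simpa [Function.comp_def, hs2] using h3

end SchutzenbergerGroup

/-! ### The bounds -/

section Bounds

variable {M : Type*} [AddCommMonoid M]

theorem principalIdeal_add_subset (x y : M) : principalIdeal (x + y) ⊆ principalIdeal x := by
  rintro _ ⟨c, rfl⟩
  exact ⟨y + c, by rw [add_assoc]⟩

theorem le_chainLength {a : M} {l : ℕ} (f : Fin (l + 1) → M) (h0 : f 0 ∈ hClass a)
    (hf : ∀ i : Fin l, principalIdeal (f i.castSucc) ⊂ principalIdeal (f i.succ)) :
    (l : ℕ∞) ≤ chainLength a := by
  classical
  refine le_iSup₂_of_le l ⟨Function.update f 0 a, by simp, ?_⟩ le_rfl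
  have key : ∀ i, principalIdeal (Function.update f 0 a i) = principalIdeal (f i) := by
    intro i
    by_cases hi : i = 0
    · subst hi
      rw [Function.update_self]
      exact (show GreenH (f 0) a from h0).symm
    · rw [Function.update_of_ne hi]
  intro i
  rw [key, key]
  exact hf i

/-- A sequence with sum in `H_a`, no proper subsequence of which has its sum in `H_a`, has length
at most `Ψ(a)`. -/
theorem card_le_chainLength {a : M} {T : Multiset M} (hT : T.sum ∈ hClass a)
    (hmin : ∀ T' < T, T'.sum ∉ hClass a) : (T.card : ℕ∞) ≤ chainLength a := by
  induction T using Quotient.inductionOn with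
  | h l =>
    have hT : l.sum ∈ hClass a := by simpa using hT
    have step : ∀ k < l.length,
        principalIdeal (l.take (k + 1)).sum ⊂ principalIdeal (l.take k).sum := by
      intro k hk
      have e : (l.take (k + 1)).sum = (l.take k).sum + l[k] := by
        rw [List.take_succ_eq_append_getElem hk, List.sum_append, List.sum_singleton]
      refine lt_of_le_of_ne (e ▸ principalIdeal_add_subset _ _) fun h => ?_
      -- If the k-th term left the ideal unchanged, adding the tail shows that deleting this term
      -- keeps the total sum in H_a, against minimality.
      have h1 := greenH_add_right (show GreenH _ _ from h) (l.drop (k + 1)).sum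
      rw [← List.sum_append, List.take_append_drop, ← List.sum_append,
        ← List.eraseIdx_eq_take_drop_succ] at h1
      refine hmin (l.eraseIdx k : List M) (lt_of_le_of_ne (List.eraseIdx_sublist l k).subperm ?_) ?_
      · intro h2
        have h3 := congrArg Multiset.card h2
        rw [Multiset.coe_card, List.length_eraseIdx_of_lt hk] at h3
        change l.length - 1 = l.length at h3
        omega
      · rw [Multiset.sum_coe]
        exact h1.symm.trans hT
    change (l.length : ℕ∞) ≤ _
    -- Prefixes are read from longest to shortest, because the chain starts at the smallest ideal.
    refine le_chainLength (fun i : Fin (l.length + 1) => (l.take (l.length - i)).sum) ?_ ?_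
    · simpa using hT
    · intro i
      have hi := i.2
      have := step (l.length - (i + 1)) (by omega)
      simp only [Fin.val_castSucc, Fin.val_succ]
      convert this using 4
      omega

/-- Split T as A + B with A minimal of sum in H_a. Reaching H_a costs at most Ψ(a) terms, and the
terms of B act on H_a as a zero-sum free sequence in Γ(H_a). -/
theorem IrreducibleSeq.card_add_one_le {a : M} {T : Multiset M} (hT : IrreducibleSeq T)
    (ha : T.sum = a) :
    (T.card : ℕ∞) + 1 ≤ chainLength a + davenport (Schutzenberger a) := by
  classical
  obtain ⟨A, ⟨hAT, hA⟩, hmin⟩ := WellFounded.has_min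
    (wellFounded_lt (α := Multiset M)) {A | A ≤ T ∧ A.sum ∈ hClass a}
    ⟨T, le_rfl, ha ▸ mem_hClass_self _⟩
  have h1 : (A.card : ℕ∞) ≤ chainLength a :=
    card_le_chainLength hA fun T' h h' => hmin T' ⟨h.le.trans hAT, h'⟩ h
  obtain ⟨B, rfl⟩ := Multiset.le_iff_exists_add.1 hAT
  obtain ⟨-, e, he⟩ := mem_hClass_iff.1 hA
  rw [Multiset.sum_add] at ha
  have hstab : ∀ b ∈ B, b ∈ stabMonoid a := by
    intro b hb
    obtain ⟨B', rfl⟩ := Multiset.exists_cons_of_mem hb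
    rw [Multiset.sum_cons] at ha
    refine mem_stabMonoid_of_eq_add (d := e + B'.sum) ?_
    calc a = A.sum + (b + B'.sum) := ha.symm
      _ = a + e + (b + B'.sum) := by rw [← he]
      _ = b + a + (e + B'.sum) := by abel
  lift B to Multiset (stabMonoid a) using hstab
  have hz : ZeroSumFree (B.map (gammaHom a)) := by
    intro T' h1 h2 h3
    obtain ⟨U, hU, rfl⟩ := exists_map_eq_of_le_map h1
    rw [← map_multiset_sum, gammaHom_eq_zero_iff] at h3
    obtain ⟨V, rfl⟩ := Multiset.le_iff_exists_add.1 hU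
    -- The subsequence U acts trivially on H_a, in particular on σ(A), so removing it does not
    -- change the total sum.
    have h4 := fix_hClass h3 hA
    rw [AddSubmonoid.coe_multiset_sum] at h4
    refine hT (A + V.map Subtype.val) (add_lt_add_right ?_ A) ?_
    · refine Multiset.map_strictMono _ ?_
      rw [lt_add_iff_pos_left]
      exact pos_iff_ne_zero.2 (by rintro rfl; simp at h2)
    · rw [Multiset.map_add, Multiset.sum_add, Multiset.sum_add, Multiset.sum_add, ← add_assoc,
        add_comm A.sum (U.map _).sum, h4]
  have h2 := hz.card_add_one_le
  rw [Multiset.card_map] at h2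
  rw [Multiset.card_add, Multiset.card_map, Nat.cast_add, add_assoc]
  exact add_le_add h1 h2

/-- Let d invert σ(C) on H_a and add the term d + a to C. A subsequence with sum a cannot avoid this
term, since otherwise a would stabilize H_a and a + a would lie in H_a. If it contains the term and
is proper, the omitted elements of C fix a, which zero-sum freeness forbids. -/
theorem exists_irreducibleSeq_of_not_greenH {a : M} (ha : ¬ GreenH (a + a) a) {n : ℕ}
    (hn : (n : ℕ∞) < davenport (Schutzenberger a)) :
    ∃ T : Multiset M, IrreducibleSeq T ∧ T.sum = a ∧ T.card = n + 1 := by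
  obtain ⟨C, hC, hmem, hs, hz⟩ := exists_lift_zeroSumFree hn (fun c => c ∈ stabMonoid a)
    fun c hc => ⟨c, hc, rfl⟩
  obtain ⟨d, hd⟩ := exists_neg_stabilizer a ⟨C.sum, hs⟩
  have hsum : (((d : M) + a) ::ₘ C).sum = a := by
    have := hd a (mem_hClass_self a)
    rw [Multiset.sum_cons, add_assoc, add_comm a]
    exact this
  refine ⟨((d : M) + a) ::ₘ C, fun T' h1 h2 => ?_, hsum, by simp [hC]⟩
  rw [hsum] at h2
  rcases le_cons_cases h1.le with h | ⟨U, hU, rfl⟩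
  · have : T'.sum ∈ stabMonoid a :=
      multiset_sum_mem _ fun c hc => hmem c (Multiset.mem_of_le h hc)
    rw [h2] at this
    exact ha (mem_stabMonoid.1 this)
  · obtain ⟨V, rfl⟩ := Multiset.le_iff_exists_add.1 hU
    refine hz V (Multiset.le_add_left _ _) (by rintro rfl; simp at h1) ?_
    rw [Multiset.sum_cons] at h2 hsum
    rw [Multiset.sum_add, ← add_assoc, h2, add_comm] at hsum
    exact hsum

/-- Here H_a contains an idempotent e, and evaluation at e embeds Γ(H_a) additively in M with a in
the image, so the irreducible representation can be found in the group. -/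
theorem exists_irreducibleSeq_of_greenH {a : M} (h0 : a ≠ 0) (ha : GreenH (a + a) a) {n : ℕ}
    (hn : (n : ℕ∞) < davenport (Schutzenberger a)) :
    ∃ T : Multiset M, IrreducibleSeq T ∧ T.sum = a ∧ n + 1 ≤ 2 * T.card := by
  obtain ⟨⟨c, hc⟩, -⟩ := mem_hClass_iff.1 (show a + a ∈ hClass a from ha)
  have hea : a + c + a = a := by
    conv_rhs => rw [hc]
    abel
  have heH : a + c ∈ hClass a := mem_hClass_iff.2 ⟨⟨a, hea.symm⟩, c, rfl⟩
  generalize a + c = e at hea heH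
  -- The element e fixes a, hence all of H_a, and it lies in H_a itself.
  have hee : e + e = e := fix_hClass hea heH
  let θ : Schutzenberger a → M := fun f => f.1 ⟨e, heH⟩
  have hθ : ∀ c : stabMonoid a, θ (gammaHom a c) = c + e := fun c => rfl
  have hadd : ∀ f g, θ (f + g) = θ f + θ g := by
    intro f g
    obtain ⟨c, rfl⟩ := gammaHom_surjective a f
    obtain ⟨d, rfl⟩ := gammaHom_surjective a g
    rw [← map_add, hθ, hθ, hθ, AddSubmonoid.coe_add]
    conv_lhs => rw [← hee]
    abel
  have hsum : ∀ U : Multiset (Schutzenberger a), U ≠ 0 → (U.map θ).sum = θ U.sum := by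
    intro U
    induction U using Multiset.induction with
    | empty => simp
    | cons x U ih =>
      intro _
      by_cases hU : U = 0
      · simp [hU]
      · rw [Multiset.map_cons, Multiset.sum_cons, Multiset.sum_cons, hadd, ih hU]
  have hinj : Function.Injective θ := by
    intro f g h
    obtain ⟨c, rfl⟩ := gammaHom_surjective a f
    obtain ⟨d, rfl⟩ := gammaHom_surjective a g
    rw [hθ, hθ] at h
    rw [gammaHom_eq_iff]
    calc (c : M) + a = c + e + a := by rw [add_assoc, hea]
      _ = d + a := by rw [h, add_assoc, hea]
  have haS : a ∈ stabMonoid a := mem_stabMonoid.2 ha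
  have hα : θ (gammaHom a ⟨a, haS⟩) = a := by
    rw [hθ, add_comm]
    exact hea
  obtain ⟨T, hT, hc⟩ := exists_zeroSumFree hn
  obtain ⟨U, hU0, hUs, hUi, hUc⟩ := hT.exists_irreducible (gammaHom a ⟨a, haS⟩)
  have hUa : (U.map θ).sum = a := by rw [hsum U hU0, hUs, hα]
  refine ⟨U.map θ, ?_, hUa, by rw [Multiset.card_map]; omega⟩
  intro T' h1
  obtain ⟨V, hV, rfl⟩ := exists_map_eq_of_lt_map h1
  rw [hUa]
  -- The empty subsequence has sum 0 in M rather than e, so it is handled separately; this is where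
  -- a ≠ 0 enters.
  by_cases hV0 : V = 0
  · subst hV0
    simpa using h0.symm
  · rw [hsum V hV0]
    exact fun h => hUi V hV hV0 (hinj (h.trans hα.symm))

variable {S : Type*} [AddCommSemigroup S] {a : AdjoinZero S}

theorem relDavenport_add_one_le (a : AdjoinZero S) :
    relDavenport a + 1 ≤ chainLength a + davenport (Schutzenberger a) := by
  by_cases htop : chainLength a + davenport (Schutzenberger a) = ⊤
  · rw [htop]; exact le_top
  lift chainLength a + davenport (Schutzenberger a) to ℕ using htop with N hN
  have h1 : relDavenport a ≤ ((N - 1 : ℕ) : ℕ∞) := by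
    refine relDavenport_le fun T hT ha => ?_
    have := hT.card_add_one_le ha
    rw [← hN] at this
    norm_cast at this ⊢
    omega
  -- The empty sequence is zero-sum free, so D(Γ(H_a)) ≥ 1 and the truncated subtraction N - 1 is
  -- genuine.
  have h2 : 1 ≤ N := by
    have hz : ZeroSumFree (0 : Multiset (Schutzenberger a)) :=
      fun T' h1 h2 => absurd (le_bot_iff.1 h1) h2
    have h3 := hz.card_add_one_le.trans (le_add_self (b := chainLength a))
    rw [← hN] at h3
    simpa using h3
  calc relDavenport a + 1 ≤ ((N - 1 : ℕ) : ℕ∞) + 1 := by gcongr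
    _ = N := by rw [← Nat.cast_add_one, Nat.sub_add_cancel h2]

theorem epsilon_mul_davenport_le (h0 : a ≠ 0) :
    epsilon a * (davenport (Schutzenberger a) : ℝ≥0∞) ≤ (relDavenport a : ℝ≥0∞) := by
  -- Testing on natural numbers below x treats finite and infinite Davenport constants together.
  have enat : ∀ {x y : ℕ∞}, (∀ n : ℕ, (n : ℕ∞) < x → (n : ℕ∞) + 1 ≤ y) → x ≤ y := by
    intro x y h
    refine ENat.forall_natCast_le_iff_le.1 fun n hn => ?_
    cases n with
    | zero => simp
    | succ n =>
      push_cast at hn ⊢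
      exact h n ((ENat.add_one_le_iff (ENat.natCast_ne_top _)).1 hn)
  unfold epsilon
  split_ifs with ha
  · have h : davenport (Schutzenberger a) ≤ 2 * relDavenport a := by
      refine enat fun n hn => ?_
      obtain ⟨T, hT, hs, hc⟩ := exists_irreducibleSeq_of_greenH h0 ha hn
      calc (n : ℕ∞) + 1 ≤ 2 * (T.card : ℕ∞) := by exact_mod_cast hc
        _ ≤ _ := by gcongr; exact le_relDavenport hT hs
    have h' := ENat.toENNReal_le.2 h
    rw [ENat.toENNReal_mul] at h'
    calc (1 / 2 : ℝ≥0∞) * _ ≤ 1 / 2 * ((2 : ℕ∞) * (relDavenport a : ℝ≥0∞)) := by gcongr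
      _ = _ := by
        rw [← mul_assoc]
        simp [ENNReal.inv_mul_cancel]
  · rw [one_mul, ENat.toENNReal_le]
    refine enat fun n hn => ?_
    obtain ⟨T, hT, hs, hc⟩ := exists_irreducibleSeq_of_not_greenH ha hn
    have := le_relDavenport hT hs
    rw [hc] at this
    exact_mod_cast this

end Bounds

theorem chainLength_ne_top {M : Type*} [AddCommMonoid M] [Finite M] (a : M) :
    chainLength a ≠ ⊤ := by
  refine ne_top_of_le_ne_top (ENat.natCast_ne_top (Nat.card M)) (iSup₂_le fun l hl => ?_)
  obtain ⟨f, -, hf⟩ := hl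
  have hmono : StrictMono fun i => principalIdeal (f i) := Fin.strictMono_iff_lt_succ.2 hf
  have hinj : Function.Injective f := fun i j h =>
    hmono.injective (congrArg principalIdeal h)
  have := Nat.card_le_card_of_injective f hinj
  rw [Nat.card_fin] at this
  exact_mod_cast (Nat.le_succ l).trans this

/-! ### Semigroups given by generators and relations -/

section Lifts

/-- A semigroup homomorphism to a monoid which maps every identity element to `0` extends to
`S⁰`. -/
def adjoinZeroLift {S N : Type*} [AddCommSemigroup S] [AddCommMonoid N] (f : S →ₙ+ N)
    (hf : ∀ e : S, (∀ s, e + s = s) → f e = 0) : AdjoinZero S →+ N :=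
  (zeroCon S).lift (WithZero.lift f) <| by
    have key : ∀ x : WithZero S, (∀ s : S, x + (s : WithZero S) = s) → WithZero.lift f x = 0 := by
      intro x hx
      induction x with
      | zero => exact map_zero _
      | coe e =>
        rw [WithZero.lift_coe]
        exact hf e fun s => WithZero.coe_inj.1 (hx s)
    rintro x y (h | ⟨h₁, h₂⟩)
    · exact congrArg _ h
    · exact (key x h₁).trans (key y h₂).symm

@[simp]
theorem adjoinZeroLift_incl {S N : Type*} [AddCommSemigroup S] [AddCommMonoid N] (f : S →ₙ+ N)
    (hf : ∀ e : S, (∀ s, e + s = s) → f e = 0) (s : S) : adjoinZeroLift f hf (incl s) = f s :=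
  rfl

variable {X : Type*} {r : Multiset X → Multiset X → Prop}

/-- The homomorphism from `⟨X | r⟩` given by the images of the generators. -/
def presentedLift {N : Type*} [AddCommMonoid N] (φ : X → N)
    (hφ : ∀ u v, r u v → (u.map φ).sum = (v.map φ).sum) : Presented r →ₙ+ N where
  toFun q := AddCon.liftOn q (fun m => (m.1.map φ).sum) <| by
    let f : FreeCommSemigroup X →ₙ+ N :=
      ⟨fun m => (m.1.map φ).sum, fun u v => by
        change ((u.1 + v.1).map φ).sum = _
        rw [Multiset.map_add, Multiset.sum_add]⟩
    have : addConGen (fun u v : FreeCommSemigroup X => r u.1 v.1) ≤ AddCon.ker f :=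
      AddCon.addConGen_le.2 fun u v h => hφ _ _ h
    exact fun u v h => this h
  map_add' p q := by
    induction p using AddCon.induction_on with
    | H u =>
      induction q using AddCon.induction_on with
      | H v =>
        change ((u.1 + v.1).map φ).sum = _
        rw [Multiset.map_add, Multiset.sum_add]
        rfl

@[simp]
theorem presentedLift_gen {N : Type*} [AddCommMonoid N] (φ : X → N)
    (hφ : ∀ u v, r u v → (u.map φ).sum = (v.map φ).sum) (x : X) :
    presentedLift φ hφ (gen r x) = φ x := by
  change (Multiset.map φ {x}).sum = φ x
  simp

/-- The class of a word, as a sum of generators. -/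
theorem incl_toQuotient (u : FreeCommSemigroup X) :
    incl (AddCon.toQuotient (c := addConGen (fun u v : FreeCommSemigroup X => r u.1 v.1)) u) =
      (u.1.map fun x => incl (gen r x)).sum := by
  obtain ⟨m, hm⟩ := u
  induction m using Multiset.induction with
  | empty => exact absurd rfl hm
  | cons x m ih =>
    by_cases h : m = 0
    · subst h
      simp [gen]
    · rw [Multiset.map_cons, Multiset.sum_cons, ← ih h]
      rfl

theorem sum_incl_gen_eq {u v : Multiset X} (hu : u ≠ 0) (hv : v ≠ 0) (h : r u v) :
    (u.map fun x => incl (gen r x)).sum = (v.map fun x => incl (gen r x)).sum := by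
  have := (AddCon.eq (addConGen (fun u v : FreeCommSemigroup X => r u.1 v.1))
    (a := ⟨u, hu⟩) (b := ⟨v, hv⟩)).2 (AddConGen.Rel.of _ _ h)
  exact ((incl_toQuotient (r := r) ⟨u, hu⟩).symm.trans (congrArg incl this)).trans
    (incl_toQuotient (r := r) ⟨v, hv⟩)

theorem presented_induction {p : AdjoinZero (Presented r) → Prop}
    (hgen : ∀ x, p (incl (gen r x))) (hadd : ∀ x y, p x → p y → p (x + y))
    (s : Presented r) : p (incl s) := by
  induction s using AddCon.induction_on with
  | H u =>
    have h := incl_toQuotient (r := r) u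
    obtain ⟨m, hm⟩ := u
    change p (incl (AddCon.toQuotient _))
    rw [h]
    clear h
    induction m using Multiset.induction with
    | empty => exact absurd rfl hm
    | cons x m ih =>
      by_cases h : m = 0
      · subst h
        simpa using hgen x
      · rw [Multiset.map_cons, Multiset.sum_cons]
        exact hadd _ _ (hgen x) (ih h)

end Lifts

/-- Positivity matters: n • x is idempotent but need not be 0, so the period starts at exponent 1.
-/
theorem nsmul_eq_of_modEq {M : Type*} [AddCommMonoid M] {x : M} {n : ℕ} (hx : (n + 1) • x = x)
    {i j : ℕ} (hi : 0 < i) (hj : 0 < j) (h : i ≡ j [MOD n]) : i • x = j • x := by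
  have key : ∀ i t : ℕ, (i + 1 + n * t) • x = (i + 1) • x := by
    intro i t
    induction t with
    | zero => simp
    | succ t ih =>
      rw [← ih, show i + 1 + n * (t + 1) = (i + n * t) + (n + 1) by ring, add_nsmul, hx,
        ← succ_nsmul]
      congr 1
      omega
  wlog hij : i ≤ j generalizing i j
  · exact (this hj hi h.symm (le_of_not_ge hij)).symm
  obtain ⟨t, ht⟩ := (Nat.modEq_iff_dvd' hij).1 h
  obtain ⟨i, rfl⟩ := Nat.exists_eq_succ_of_ne_zero hi.ne'
  rw [show j = i + 1 + n * t by omega, key]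

/-! ### A chain of cyclic groups -/

section Chain

variable {n r : ℕ}

/-- The generator `x_i` in `S⁰`. -/
def chainGen (n : ℕ) {r : ℕ} (i : Fin r) : AdjoinZero (Presented (ChainRel n r)) :=
  incl (gen (ChainRel n r) i)

theorem chainGen_period (i : Fin r) : (n + 1) • chainGen n i = chainGen n i := by
  have := sum_incl_gen_eq (by simp) (by simp) (ChainRel.period (n := n) i)
  simpa [Multiset.map_nsmul, Multiset.sum_nsmul, chainGen] using this

theorem chainGen_absorb {i j : Fin r} (h : i < j) :
    chainGen n i + chainGen n j = chainGen n j := by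
  have := sum_incl_gen_eq (by simp) (by simp) (ChainRel.absorb (n := n) i j h)
  simpa [chainGen] using this

theorem chainGen_nsmul_absorb {i j : Fin r} (h : i < j) (s : ℕ) {t : ℕ} (ht : 0 < t) :
    s • chainGen n i + t • chainGen n j = t • chainGen n j := by
  obtain ⟨t, rfl⟩ := Nat.exists_eq_succ_of_ne_zero ht.ne'
  induction s with
  | zero => simp
  | succ s ih =>
    rw [succ_nsmul, add_assoc, Nat.succ_eq_add_one, succ_nsmul (chainGen n j) t,
      add_left_comm (chainGen n i), chainGen_absorb h, ← succ_nsmul]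
    exact ih

/-- In a sum of positive multiples of two generators, the one of larger index absorbs the other. The
index k only serves to write 0 as a multiple. -/
theorem exists_eq_nsmul_chainGen (k : Fin r) (x : AdjoinZero (Presented (ChainRel n r))) :
    ∃ (i : Fin r) (j : ℕ), x = j • chainGen n i := by
  rcases eq_zero_or_incl x with rfl | ⟨s, rfl⟩
  · exact ⟨k, 0, by simp⟩
  refine presented_induction (p := fun x => ∃ (i : Fin r) (j : ℕ), x = j • chainGen n i)
    (fun i => ⟨i, 1, by simp [chainGen]⟩) ?_ s
  rintro _ _ ⟨i, s, rfl⟩ ⟨j, t, rfl⟩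
  rcases Nat.eq_zero_or_pos s with rfl | hs
  · exact ⟨j, t, by simp⟩
  rcases Nat.eq_zero_or_pos t with rfl | ht
  · exact ⟨i, s, by simp⟩
  rcases lt_trichotomy i j with h | rfl | h
  · exact ⟨j, t, chainGen_nsmul_absorb h s ht⟩
  · exact ⟨i, s + t, (add_nsmul _ _ _).symm⟩
  · exact ⟨i, s, by rw [add_comm]; exact chainGen_nsmul_absorb h t hs⟩

theorem finite_chain (hn : 0 < n) (k : Fin r) :
    Finite (AdjoinZero (Presented (ChainRel n r))) := by
  refine Finite.of_surjective
    (fun p : Fin r × Fin (n + 1) => (p.2 : ℕ) • chainGen n p.1) fun x => ?_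
  obtain ⟨i, j, rfl⟩ := exists_eq_nsmul_chainGen k x
  rcases Nat.eq_zero_or_pos j with rfl | hj
  · exact ⟨(i, 0), by simp⟩
  -- Residues are represented in [1, n], since the multiple 0 is the identity and stands apart.
  · refine ⟨(i, ⟨(j - 1) % n + 1, by have := Nat.mod_lt (j - 1) hn; omega⟩), ?_⟩
    refine nsmul_eq_of_modEq (chainGen_period i) (by simp) hj ?_
    have : (j - 1) % n + 1 ≡ (j - 1) + 1 [MOD n] := (Nat.mod_modEq _ _).add_right 1
    rwa [Nat.sub_add_cancel hj] at this

/-- The value of the generator `x_i` under the homomorphism that isolates the component of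
`x_k`. -/
def chainValue (n : ℕ) {r : ℕ} (k i : Fin r) : WithTop (ZMod n) :=
  if i < k then 0 else if i = k then ((1 : ZMod n) : WithTop (ZMod n)) else ⊤

theorem chainValue_self (k : Fin r) :
    chainValue n k k = ((1 : ZMod n) : WithTop (ZMod n)) := by
  simp [chainValue]

theorem chainValue_lt {i k : Fin r} (h : i < k) : chainValue n k i = 0 := by
  simp [chainValue, h]

theorem chainValue_gt {i k : Fin r} (h : k < i) : chainValue n k i = ⊤ := by
  simp [chainValue, h.ne', h.le]

theorem sum_chainValue_eq (k : Fin r) (u v : Multiset (Fin r)) (h : ChainRel n r u v) :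
    (u.map (chainValue n k)).sum = (v.map (chainValue n k)).sum := by
  rcases h with i | ⟨i, j, h⟩
  · rw [Multiset.map_nsmul, Multiset.sum_nsmul, Multiset.map_singleton, Multiset.sum_singleton]
    rcases lt_trichotomy i k with h | rfl | h
    · rw [chainValue_lt h, smul_zero]
    · rw [chainValue_self, ← WithTop.coe_nsmul]
      simp
    · rw [chainValue_gt h, succ_nsmul, WithTop.add_top]
  · rw [Multiset.map_add, Multiset.sum_add]
    simp only [Multiset.map_singleton, Multiset.sum_singleton]
    rcases lt_or_ge k j with hk | hk
    · rw [chainValue_gt hk, WithTop.add_top]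
    · rw [chainValue_lt (h.trans_le hk), zero_add]

/-- The homomorphism to `ℤ/n ∪ {⊤}` that maps `x_i` to `0`, `1` or `⊤` according to whether
`i < k`, `i = k` or `i > k`. -/
def chainHom (n : ℕ) {r : ℕ} (k : Fin r) :
    AdjoinZero (Presented (ChainRel n r)) →+ WithTop (ZMod n) :=
  adjoinZeroLift (presentedLift (chainValue n k) (sum_chainValue_eq k)) <| by
    intro e he
    -- An identity e satisfies e + x_k = x_k, so its value y satisfies y + 1 = 1.
    have := congrArg (presentedLift (chainValue n k) (sum_chainValue_eq k)) (he (gen _ k))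
    rw [map_add, presentedLift_gen, chainValue_self] at this
    generalize presentedLift (chainValue n k) _ e = y at this
    induction y with
    | top => simp at this
    | coe y =>
      rw [← WithTop.coe_add, WithTop.coe_inj, add_eq_right] at this
      rw [this, WithTop.coe_zero]

theorem chainHom_chainGen (k i : Fin r) : chainHom n k (chainGen n i) = chainValue n k i := by
  simp [chainHom, chainGen]

theorem chainHom_nsmul_self (k : Fin r) (j : ℕ) :
    chainHom n k (j • chainGen n k) = ((j : ZMod n) : WithTop (ZMod n)) := by
  rw [map_nsmul, chainHom_chainGen, chainValue_self, ← WithTop.coe_nsmul]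
  simp

theorem nsmul_chainGen_eq_iff {k : Fin r} {i j : ℕ} (hi : 0 < i) (hj : 0 < j) :
    i • chainGen n k = j • chainGen n k ↔ i ≡ j [MOD n] := by
  refine ⟨fun h => ?_, nsmul_eq_of_modEq (chainGen_period k) hi hj⟩
  have := congrArg (chainHom n k) h
  rwa [chainHom_nsmul_self, chainHom_nsmul_self, WithTop.coe_inj, ZMod.natCast_eq_natCast_iff]
    at this

/-- Only multiples of x_k take nonzero finite values. The value 0 is excluded because it is shared
with 0 and the multiples of x_i for i < k. -/
theorem eq_of_chainHom_eq {k : Fin r} {x : AdjoinZero (Presented (ChainRel n r))} {s : ℕ}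
    (hs : (s : ZMod n) ≠ 0)
    (h : chainHom n k x = ((s : ZMod n) : WithTop (ZMod n))) : x = s • chainGen n k := by
  obtain ⟨i, j, rfl⟩ := exists_eq_nsmul_chainGen k x
  have hj : 0 < j := by
    refine Nat.pos_of_ne_zero ?_
    rintro rfl
    rw [zero_nsmul, map_zero, ← WithTop.coe_zero, WithTop.coe_inj] at h
    exact hs h.symm
  have hs0 : 0 < s := Nat.pos_of_ne_zero (by rintro rfl; simp at hs)
  rcases lt_trichotomy i k with hi | rfl | hi
  · rw [map_nsmul, chainHom_chainGen, chainValue_lt hi, smul_zero, ← WithTop.coe_zero,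
      WithTop.coe_inj] at h
    exact absurd h.symm hs
  · rw [chainHom_nsmul_self, WithTop.coe_inj, ZMod.natCast_eq_natCast_iff] at h
    exact (nsmul_chainGen_eq_iff hj hs0).2 h
  · obtain ⟨j, rfl⟩ := Nat.exists_eq_succ_of_ne_zero hj.ne'
    rw [map_nsmul, chainHom_chainGen, chainValue_gt hi, Nat.succ_eq_add_one, succ_nsmul,
      WithTop.add_top] at h
    exact absurd h WithTop.top_ne_coe

/-- Generators below x_k fix a, those above move it out of its class to value ⊤, so x_k alone
generates the action, with order n. -/
theorem davenport_chain {s : ℕ} (hn : 0 < n) (hs : 0 < s) (k : Fin r) :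
    davenport (Schutzenberger (s • chainGen n k)) = n := by
  have := finite_chain hn k
  refine davenport_schutzenberger_of_generator (Set.toFinite _) (u := chainGen n k) ?_ ?_ ?_
  · refine mem_stabMonoid_of_eq_add (d := (n - 1) • chainGen n k) ?_
    rw [← succ_nsmul', ← add_nsmul, nsmul_chainGen_eq_iff hs (by omega),
      show s + 1 + (n - 1) = s + n by omega]
    simp [Nat.ModEq]
  · intro j
    rw [← add_nsmul, nsmul_chainGen_eq_iff (by omega) hs]
    rw [← Nat.modEq_zero_iff_dvd]
    exact ⟨fun h => Nat.ModEq.add_right_cancel' s (by rwa [zero_add]),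
      fun h => by simpa using h.add_right s⟩
  · intro c hc
    obtain ⟨i, j, rfl⟩ := exists_eq_nsmul_chainGen k c
    rcases lt_trichotomy i k with hi | rfl | hi
    · exact ⟨0, by rw [chainGen_nsmul_absorb hi j hs, zero_nsmul, zero_add]⟩
    · exact ⟨j, rfl⟩
    · rcases Nat.eq_zero_or_pos j with rfl | hj
      · exact ⟨0, by simp⟩
      obtain ⟨⟨d, hd⟩, -⟩ := mem_hClass_iff.1 (mem_stabMonoid.1 hc)
      obtain ⟨j, rfl⟩ := Nat.exists_eq_succ_of_ne_zero hj.ne'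
      have := congrArg (chainHom n k) hd
      rw [map_add, map_add, chainHom_nsmul_self, map_nsmul, chainHom_chainGen, chainValue_gt hi,
        Nat.succ_eq_add_one, succ_nsmul, WithTop.add_top, WithTop.top_add, WithTop.top_add] at this
      exact absurd this WithTop.coe_ne_top

theorem natCast_half_ne_zero {h : ℕ} (hh : 0 < h) : ((h : ℕ) : ZMod (2 * h)) ≠ 0 := by
  rw [Ne, ZMod.natCast_eq_zero_iff]
  intro hd
  have := Nat.le_of_dvd hh hd
  omega

/-- Modulo h, T with one term removed is zero-sum free: a subsum divisible by h has value 0 or h in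
ℤ/2h, and then the complement or the subsequence itself already has sum a. Hence |T| ≤ D(ℤ/h) ≤ h.
-/
theorem card_le_of_irreducibleSeq_chain {h : ℕ} (hh : 0 < h) (k : Fin r)
    {T : Multiset (AdjoinZero (Presented (ChainRel (2 * h) r)))} (hT : IrreducibleSeq T)
    (hs : T.sum = h • chainGen (2 * h) k) : T.card ≤ h := by
  have : NeZero h := ⟨hh.ne'⟩
  set f := chainHom (2 * h) k
  let g : ZMod (2 * h) →+* ZMod h := ZMod.castHom (Dvd.intro_left 2 rfl) (ZMod h)
  have hfT : f T.sum = ((h : ZMod (2 * h)) : WithTop (ZMod (2 * h))) := by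
    rw [hs, chainHom_nsmul_self]
  have hsplit : ∀ U V, T = U + V → f U.sum = ((h : ZMod (2 * h)) : WithTop _) → V = 0 := by
    intro U V e hU
    by_contra hV
    refine hT U ?_ ?_
    · rw [e, lt_add_iff_pos_right]
      exact pos_iff_ne_zero.2 hV
    · rw [hs, eq_of_chainHom_eq (natCast_half_ne_zero hh) hU]
  -- A finite sum has finite terms, so the default value of `untopD` never occurs.
  have hmap : ∀ U : Multiset _, ∀ y : ZMod (2 * h), f U.sum = (y : WithTop (ZMod (2 * h))) →
      (U.map fun x => g ((f x).untopD 0)).sum = g y := by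
    intro U
    induction U using Multiset.induction with
    | empty =>
      intro y hy
      rw [Multiset.sum_zero, map_zero, ← WithTop.coe_zero, WithTop.coe_inj] at hy
      simp [← hy]
    | cons x U ih =>
      intro y hy
      rw [Multiset.sum_cons, map_add] at hy
      obtain ⟨p, q, hp, hq, rfl⟩ := WithTop.add_eq_coe.1 hy
      rw [Multiset.map_cons, Multiset.sum_cons, ih q hq.symm, ← hp, WithTop.untopD_coe, map_add]
  -- Setting t aside ensures that a subsequence of the rest has a nonempty complement.
  obtain ⟨t, T, rfl⟩ : ∃ t U, T = t ::ₘ U := by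
    have hne : T ≠ 0 := by
      rintro rfl
      rw [Multiset.sum_zero, map_zero, ← WithTop.coe_zero, WithTop.coe_inj] at hfT
      exact natCast_half_ne_zero hh hfT.symm
    obtain ⟨t, ht⟩ := Multiset.exists_mem_of_ne_zero hne
    obtain ⟨U, hU⟩ := Multiset.exists_cons_of_mem ht
    exact ⟨t, U, hU⟩
  have hz : ZeroSumFree (T.map fun x => g ((f x).untopD 0)) := by
    intro T' h1 h2 h3
    obtain ⟨U, hU, rfl⟩ := exists_map_eq_of_le_map h1
    obtain ⟨V, rfl⟩ := Multiset.le_iff_exists_add.1 hU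
    have e : t ::ₘ (U + V) = U + t ::ₘ V := by simp
    have hfs : f U.sum + f (t ::ₘ V).sum = ((h : ZMod (2 * h)) : WithTop (ZMod (2 * h))) := by
      rw [← map_add, ← Multiset.sum_add, ← e, hfT]
    obtain ⟨y, z, hy, hz, hyz⟩ := WithTop.add_eq_coe.1 hfs
    rw [hmap U y hy.symm, ← ZMod.natCast_zmod_val y, map_natCast, ZMod.natCast_eq_zero_iff] at h3
    have hlt := ZMod.val_lt y
    have hyv := ZMod.natCast_zmod_val y
    obtain ⟨c, hc⟩ := h3
    have hc2 : c < 2 := by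
      by_contra hc2
      have : h * 2 ≤ h * c := Nat.mul_le_mul_left h (not_lt.1 hc2)
      omega
    interval_cases c
    · rw [hc, mul_zero, Nat.cast_zero] at hyv
      rw [← hyv, zero_add] at hyz
      have := hsplit (t ::ₘ V) U (by rw [e, add_comm]) (by rw [← hz, hyz])
      subst this
      simp at h2
    · rw [hc, mul_one] at hyv
      have := hsplit U (t ::ₘ V) e (by rw [← hy, hyv])
      simp at this
  have h1 := hz.card_add_one_le.trans (davenport_le_card _)
  rw [Multiset.card_map, Nat.card_zmod] at h1
  rw [Multiset.card_cons]
  exact_mod_cast h1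

theorem chain_sharp {h r : ℕ} (k : Fin r) (hh : 0 < h)
    {a : AdjoinZero (Presented (ChainRel (2 * h) r))} (ha : a = h • chainGen (2 * h) k) :
    a ≠ 0 ∧ chainLength a ≠ ⊤ ∧ (hClass a).Finite ∧ GreenH (a + a) a ∧
      davenport (Schutzenberger a) = (2 * h : ℕ) ∧
      epsilon a * (davenport (Schutzenberger a) : ℝ≥0∞) = (relDavenport a : ℝ≥0∞) := by
  have := finite_chain (n := 2 * h) (by omega) k
  have h0 : a ≠ 0 := by
    intro h0
    have := congrArg (chainHom (2 * h) k) (ha.symm.trans h0)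
    rw [chainHom_nsmul_self, map_zero, ← WithTop.coe_zero, WithTop.coe_inj] at this
    exact natCast_half_ne_zero hh this
  have hG : GreenH (a + a) a := by
    refine mem_hClass_iff.2 ⟨⟨a, ?_⟩, a, rfl⟩
    rw [ha, ← add_nsmul, ← add_nsmul, nsmul_chainGen_eq_iff hh (by omega),
      show h + h + h = h + 2 * h by ring]
    simp [Nat.ModEq]
  have hD : davenport (Schutzenberger a) = (2 * h : ℕ) := by
    rw [ha]
    exact davenport_chain (by omega) hh k
  refine ⟨h0, chainLength_ne_top a, Set.toFinite _, hG, hD,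
    le_antisymm (epsilon_mul_davenport_le h0) ?_⟩
  have hle : relDavenport a ≤ (h : ℕ∞) := relDavenport_le fun T hT hs =>
    Nat.cast_le.2 (card_le_of_irreducibleSeq_chain hh k hT (hs.trans ha))
  refine (ENat.toENNReal_le.2 hle).trans ?_
  rw [hD, epsilon, if_pos hG]
  push_cast
  rw [← mul_assoc]
  simp [ENNReal.inv_mul_cancel]

end Chain

/-! ### A torsor under a cyclic group, with a zero element -/

section Torsor

variable {m : ℕ}

/-- The generator `x_0` in `S⁰`. -/
def torsorBase (m : ℕ) : AdjoinZero (Presented (TorsorRel m)) := incl (gen (TorsorRel m) .base)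

/-- The generator `x_k` in `S⁰`, for `k` modulo `m`. -/
def torsorPoint (k : ZMod m) : AdjoinZero (Presented (TorsorRel m)) :=
  incl (gen (TorsorRel m) (.point k))

/-- The zero element `∞` in `S⁰`. -/
def torsorInfty (m : ℕ) : AdjoinZero (Presented (TorsorRel m)) := incl (gen (TorsorRel m) .infty)

theorem torsorBase_period : (m + 1) • torsorBase m = torsorBase m := by
  have := sum_incl_gen_eq (by simp) (by simp) (TorsorRel.period (m := m))
  simpa [Multiset.map_nsmul, Multiset.sum_nsmul, torsorBase] using this

theorem torsorBase_add_torsorPoint (k : ZMod m) :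
    torsorBase m + torsorPoint k = torsorPoint (k + 1) := by
  have := sum_incl_gen_eq (by simp) (by simp) (TorsorRel.shift k)
  simpa [torsorBase, torsorPoint] using this

theorem torsorPoint_add_torsorPoint (i j : ZMod m) :
    torsorPoint i + torsorPoint j = torsorInfty m := by
  have := sum_incl_gen_eq (by simp) (by simp) (TorsorRel.collapse i j)
  simpa [torsorInfty, torsorPoint] using this

theorem torsorInfty_add (x : AdjoinZero (Presented (TorsorRel m))) :
    torsorInfty m + x = torsorInfty m := by
  rcases eq_zero_or_incl x with rfl | ⟨s, rfl⟩
  · exact add_zero _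
  refine presented_induction (p := fun x => torsorInfty m + x = torsorInfty m) (fun y => ?_) ?_ s
  · have := sum_incl_gen_eq (by simp) (by simp) (TorsorRel.infty y)
    simpa [torsorInfty] using this
  · intro x y hx hy
    rw [← add_assoc, hx, hy]

theorem nsmul_torsorBase_add_torsorPoint (j : ℕ) (k : ZMod m) :
    j • torsorBase m + torsorPoint k = torsorPoint (k + (j : ZMod m)) := by
  induction j with
  | zero => simp
  | succ j ih =>
    rw [succ_nsmul', add_assoc, ih, torsorBase_add_torsorPoint]
    push_cast
    rw [add_assoc]

/-- Positive multiples are kept here because the relation (m + 1) x_0 = x_0 says nothing about 0;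
`nsmul_torsorBase_eq_zero` depends on this. -/
theorem torsor_cases_of_incl (s : Presented (TorsorRel m)) :
    (∃ j : ℕ, 0 < j ∧ incl s = j • torsorBase m) ∨ (∃ k, incl s = torsorPoint k) ∨
      incl s = torsorInfty m := by
  refine presented_induction (p := fun x => (∃ j : ℕ, 0 < j ∧ x = j • torsorBase m) ∨
    (∃ k, x = torsorPoint k) ∨ x = torsorInfty m) ?_ ?_ s
  · rintro (_ | k | _)
    · exact Or.inl ⟨1, one_pos, (one_nsmul _).symm⟩
    · exact Or.inr (Or.inl ⟨k, rfl⟩)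
    · exact Or.inr (Or.inr rfl)
  · rintro x y (⟨i, hi, rfl⟩ | ⟨k, rfl⟩ | rfl) (⟨j, hj, rfl⟩ | ⟨l, rfl⟩ | rfl)
    · exact Or.inl ⟨i + j, by omega, (add_nsmul _ _ _).symm⟩
    · exact Or.inr (Or.inl ⟨_, nsmul_torsorBase_add_torsorPoint _ _⟩)
    · exact Or.inr (Or.inr (by rw [add_comm, torsorInfty_add]))
    · exact Or.inr (Or.inl ⟨_, by rw [add_comm, nsmul_torsorBase_add_torsorPoint]⟩)
    · exact Or.inr (Or.inr (torsorPoint_add_torsorPoint _ _))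
    · exact Or.inr (Or.inr (by rw [add_comm, torsorInfty_add]))
    all_goals exact Or.inr (Or.inr (torsorInfty_add _))

/-- The element m x_0 acts as an identity on S, and `AdjoinZero` identifies any identity of S with
0. Thus x_0 is a unit. -/
theorem nsmul_torsorBase_eq_zero : m • torsorBase m = 0 := by
  rcases eq_zero_or_incl (m • torsorBase m) with h | ⟨e, he⟩
  · exact h
  rw [he, incl_eq_zero_iff]
  intro s
  apply incl_injective
  rw [incl_add, ← he]
  rcases torsor_cases_of_incl s with ⟨j, hj, h⟩ | ⟨k, h⟩ | h
  · rw [h, ← add_nsmul]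
    exact nsmul_eq_of_modEq torsorBase_period (by omega) hj (by simp [Nat.ModEq])
  · rw [h, nsmul_torsorBase_add_torsorPoint, ZMod.natCast_self, add_zero]
  · rw [h, add_comm, torsorInfty_add]

theorem torsor_cases (x : AdjoinZero (Presented (TorsorRel m))) :
    (∃ j : ℕ, x = j • torsorBase m) ∨ (∃ k, x = torsorPoint k) ∨ x = torsorInfty m := by
  rcases eq_zero_or_incl x with rfl | ⟨s, rfl⟩
  · exact Or.inl ⟨0, (zero_nsmul _).symm⟩
  rcases torsor_cases_of_incl s with ⟨j, -, h⟩ | h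
  · exact Or.inl ⟨j, h⟩
  · exact Or.inr h

theorem finite_torsor (hm : 0 < m) : Finite (AdjoinZero (Presented (TorsorRel m))) := by
  have : NeZero m := ⟨hm.ne'⟩
  refine Set.finite_univ_iff.1 (Set.Finite.subset
    (((Set.finite_range fun j : Fin m => (j : ℕ) • torsorBase m).union
      (Set.finite_range torsorPoint)).union (Set.finite_singleton (torsorInfty m))) ?_)
  intro x _
  rcases torsor_cases x with ⟨j, rfl⟩ | ⟨k, rfl⟩ | rfl
  · refine Or.inl (Or.inl ⟨⟨j % m, Nat.mod_lt _ hm⟩, ?_⟩)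
    conv_rhs => rw [← Nat.mod_add_div j m, add_nsmul, mul_comm, mul_nsmul']
    simp [nsmul_torsorBase_eq_zero]
  · exact Or.inl (Or.inr ⟨k, rfl⟩)
  · exact Or.inr rfl

/-- The values of the generators in the dual numbers over the group ring `ℤ[ℤ/m]`. -/
noncomputable def torsorValue (m : ℕ) :
    TorsorGen m → Additive (DualNumber (AddMonoidAlgebra ℤ (ZMod m)))
  | .base => .ofMul (TrivSqZeroExt.inl (AddMonoidAlgebra.single 1 1))
  | .point k => .ofMul (TrivSqZeroExt.inr (AddMonoidAlgebra.single k 1))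
  | .infty => .ofMul 0

theorem sum_torsorValue_eq (u v : Multiset (TorsorGen m)) (h : TorsorRel m u v) :
    (u.map (torsorValue m)).sum = (v.map (torsorValue m)).sum := by
  rcases h with _ | k | ⟨i, j⟩ | y
  · rw [Multiset.map_nsmul, Multiset.sum_nsmul, Multiset.map_singleton, Multiset.sum_singleton,
      torsorValue, ← ofMul_pow, TrivSqZeroExt.inl_pow, AddMonoidAlgebra.single_pow]
    simp
  all_goals
    rw [Multiset.map_add, Multiset.sum_add]
    simp only [Multiset.map_singleton, Multiset.sum_singleton]
  · rw [torsorValue, torsorValue, torsorValue, ← ofMul_mul, TrivSqZeroExt.inl_mul_inr, smul_eq_mul,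
      AddMonoidAlgebra.single_mul_single, mul_one, add_comm]
  · rw [torsorValue, torsorValue, torsorValue, ← ofMul_mul, TrivSqZeroExt.inr_mul_inr]
  · rw [torsorValue, ← ofMul_toMul (torsorValue m y), ← ofMul_mul, zero_mul]

/-- The homomorphism to the multiplicative monoid of the dual numbers over `ℤ[ℤ/m]`. -/
noncomputable def torsorHom (m : ℕ) : AdjoinZero (Presented (TorsorRel m)) →+
    Additive (DualNumber (AddMonoidAlgebra ℤ (ZMod m))) :=
  adjoinZeroLift (presentedLift (torsorValue m) sum_torsorValue_eq) <| by
    intro e he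
    have := congrArg (presentedLift (torsorValue m) sum_torsorValue_eq) (he (gen _ .base))
    rw [map_add, presentedLift_gen, torsorValue] at this
    generalize presentedLift (torsorValue m) _ e = y at this
    -- The image of x_0 is a unit, with the group element -1 as inverse, so it cancels from e + x_0
    -- = x_0.
    have h2 := congrArg (· + Additive.ofMul (TrivSqZeroExt.inl
      (AddMonoidAlgebra.single (-1 : ZMod m) (1 : ℤ)) :
        DualNumber (AddMonoidAlgebra ℤ (ZMod m)))) this
    simp only [add_assoc] at h2
    rw [← ofMul_mul, ← TrivSqZeroExt.inl_mul, AddMonoidAlgebra.single_mul_single] at h2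
    simpa [← AddMonoidAlgebra.one_def] using h2

theorem torsorHom_torsorPoint (k : ZMod m) : torsorHom m (torsorPoint k) =
    .ofMul (TrivSqZeroExt.inr (AddMonoidAlgebra.single k 1)) := by
  simp [torsorHom, torsorPoint, torsorValue]

theorem torsorHom_torsorInfty : torsorHom m (torsorInfty m) = .ofMul 0 := by
  simp [torsorHom, torsorInfty, torsorValue]

theorem torsorPoint_injective : Function.Injective (torsorPoint (m := m)) := by
  intro i j h
  have := congrArg (torsorHom m) h
  rw [torsorHom_torsorPoint, torsorHom_torsorPoint] at this
  have := TrivSqZeroExt.inr_injective (Additive.ofMul.injective this)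
  exact AddMonoidAlgebra.single_left_injective one_ne_zero this

theorem torsorPoint_ne_torsorInfty (k : ZMod m) : torsorPoint k ≠ torsorInfty m := by
  intro h
  have := congrArg (torsorHom m) h
  rw [torsorHom_torsorPoint, torsorHom_torsorInfty] at this
  have := congrArg TrivSqZeroExt.snd (Additive.ofMul.injective this)
  simp at this

theorem torsorPoint_ne_zero (k : ZMod m) : torsorPoint k ≠ 0 := by
  intro h
  have := congrArg (torsorHom m) h
  rw [torsorHom_torsorPoint, map_zero] at this
  have := congrArg TrivSqZeroExt.fst (Additive.ofMul.injective (this.trans ofMul_one.symm))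
  simp at this

/-- Only multiples of x_0 generate strictly larger ideals than a point: the other points generate
the same ideal and ∞ generates a smaller one. These multiples are units, so the chain stops there.
-/
theorem chainLength_torsorPoint_le [NeZero m] (k : ZMod m) : chainLength (torsorPoint k) ≤ 1 := by
  refine iSup₂_le fun l hl => ?_
  obtain ⟨f, h0, hf⟩ := hl
  by_contra hl
  have hl : 1 < l := by exact_mod_cast not_le.1 hl
  have h1 := hf ⟨0, by omega⟩
  have h2 := hf ⟨1, by omega⟩
  change principalIdeal (f 0) ⊂ principalIdeal (f ⟨1, _⟩) at h1
  change principalIdeal (f ⟨1, _⟩) ⊂ _ at h2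
  rw [h0] at h1
  generalize f ⟨1, _⟩ = y at h1 h2
  rcases torsor_cases y with ⟨j, rfl⟩ | ⟨i, rfl⟩ | rfl
  · refine h2.2 fun x _ => ⟨(j * (m - 1)) • torsorBase m + x, ?_⟩
    have : j + j * (m - 1) = m * j := by
      have := NeZero.pos m
      obtain ⟨t, rfl⟩ := Nat.exists_eq_succ_of_ne_zero this.ne'
      rw [Nat.succ_sub_one, Nat.succ_eq_add_one]
      ring
    rw [← add_assoc, ← add_nsmul, this, mul_comm, mul_nsmul', nsmul_torsorBase_eq_zero,
      nsmul_zero, zero_add]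
  · refine h1.2 ?_
    have : torsorPoint i = torsorPoint k + (i - k).val • torsorBase m := by
      rw [add_comm, nsmul_torsorBase_add_torsorPoint, ZMod.natCast_zmod_val, add_sub_cancel]
    rw [this]
    exact principalIdeal_add_subset _ _
  · obtain ⟨c, hc⟩ := h1.1 ⟨0, (add_zero _).symm⟩
    rw [torsorInfty_add] at hc
    exact torsorPoint_ne_torsorInfty k hc

theorem not_greenH_torsorPoint (k : ZMod m) :
    ¬ GreenH (torsorPoint k + torsorPoint k) (torsorPoint k) := by
  intro h
  obtain ⟨⟨d, hd⟩, -⟩ := mem_hClass_iff.1 (show _ ∈ hClass (torsorPoint k) from h)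
  rw [torsorPoint_add_torsorPoint, torsorInfty_add] at hd
  exact torsorPoint_ne_torsorInfty k hd

theorem davenport_torsor (hm : 0 < m) (k : ZMod m) :
    davenport (Schutzenberger (torsorPoint k)) = m := by
  have := finite_torsor hm
  refine davenport_schutzenberger_of_generator (Set.toFinite _) (u := torsorBase m) ?_ ?_ ?_
  · refine mem_stabMonoid_of_eq_add (d := (m - 1) • torsorBase m) ?_
    rw [torsorBase_add_torsorPoint, add_comm, nsmul_torsorBase_add_torsorPoint, Nat.cast_sub hm]
    simp
  · intro j
    rw [nsmul_torsorBase_add_torsorPoint, torsorPoint_injective.eq_iff, add_eq_left,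
      ZMod.natCast_eq_zero_iff]
  · intro c hc
    have hI : torsorInfty m ∉ hClass (torsorPoint k) := by
      intro h
      obtain ⟨⟨d, hd⟩, -⟩ := mem_hClass_iff.1 h
      rw [torsorInfty_add] at hd
      exact torsorPoint_ne_torsorInfty k hd
    have hc := mem_stabMonoid.1 hc
    rcases torsor_cases c with ⟨j, rfl⟩ | ⟨i, rfl⟩ | rfl
    · exact ⟨j, rfl⟩
    · rw [torsorPoint_add_torsorPoint] at hc
      exact absurd hc hI
    · rw [torsorInfty_add] at hc
      exact absurd hc hI

theorem torsor_sharp (hm : 0 < m) (k : ZMod m) {a : AdjoinZero (Presented (TorsorRel m))}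
    (ha : a = torsorPoint k) :
    a ≠ 0 ∧ chainLength a ≠ ⊤ ∧ (hClass a).Finite ∧ ¬ GreenH (a + a) a ∧
      davenport (Schutzenberger a) = m ∧
      epsilon a * (davenport (Schutzenberger a) : ℝ≥0∞) = (relDavenport a : ℝ≥0∞) := by
  have := finite_torsor hm
  have : NeZero m := ⟨hm.ne'⟩
  subst ha
  have hG := not_greenH_torsorPoint k
  refine ⟨torsorPoint_ne_zero k, chainLength_ne_top _, Set.toFinite _, hG, davenport_torsor hm k,
    le_antisymm (epsilon_mul_davenport_le (torsorPoint_ne_zero k)) ?_⟩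
  rw [epsilon, if_neg hG, one_mul, ENat.toENNReal_le,
    ← ENat.add_le_add_iff_left ENat.one_ne_top]
  have h1 := relDavenport_add_one_le (torsorPoint k)
  rw [add_comm] at h1
  exact h1.trans (add_le_add_left (chainLength_torsorPoint_le k) _)

end Torsor

/-! ### Appending units to an irreducible sequence -/

section AppendUnits

variable {M : Type*} [AddCommMonoid M]

theorem mem_hClass_of_add_isAddUnit {a x w : M} (hw : IsAddUnit w) (h : x + w = a) :
    x ∈ hClass a := by
  obtain ⟨w', hw'⟩ := hw.exists_neg
  exact mem_hClass_iff.2 ⟨⟨w, h.symm⟩, w', by rw [← h, add_assoc, hw', add_zero]⟩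

/-- Suppose that every element of the Schützenberger group is induced by a unit. A nonempty
sequence with sum in `H_a` which has no proper subsequence with sum in `H_a` can, after a change by
units, be extended to an irreducible sequence with sum `a` by any number `n < D(Γ(H_a))` of
terms. -/
theorem exists_irreducibleSeq_of_units {a : M}
    (hunit : ∀ c ∈ stabMonoid a, ∃ u, IsAddUnit u ∧ u + a = c + a) {Q : Multiset M}
    (hQ0 : Q ≠ 0) (hQ : Q.sum ∈ hClass a) (hmin : ∀ Q' < Q, Q'.sum ∉ hClass a) {n : ℕ}
    (hn : (n : ℕ∞) < davenport (Schutzenberger a)) :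
    ∃ T : Multiset M, IrreducibleSeq T ∧ T.sum = a ∧ T.card = Q.card + n := by
  obtain ⟨C, hC, hCu, -, hz⟩ := exists_lift_zeroSumFree hn IsAddUnit hunit
  have hCle : ∀ C' ≤ C, IsAddUnit C'.sum := fun C' hC' =>
    multiset_sum_mem (S := IsAddUnit.addSubmonoid M) _ fun c hc =>
      hCu c (Multiset.mem_of_le hC' hc)
  obtain ⟨q, hq⟩ := Multiset.exists_mem_of_ne_zero hQ0
  obtain ⟨Q, rfl⟩ := Multiset.exists_cons_of_mem hq
  rw [Multiset.sum_cons] at hQ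
  -- The unit v cancels σ(C) and carries the sum of the sequence to a; absorbing it into the term q
  -- costs no extra term.
  obtain ⟨v, hv, hva⟩ : ∃ v, IsAddUnit v ∧ q + Q.sum + v + C.sum = a := by
    obtain ⟨⟨d, hd⟩, e, he⟩ := mem_hClass_iff.1 hQ
    have hd' : d ∈ stabMonoid a := by
      refine mem_stabMonoid_of_eq_add (d := e) ?_
      conv_lhs => rw [hd, he]
      abel
    obtain ⟨u, hu, hua⟩ := hunit d hd'
    obtain ⟨w, hw⟩ := (hCle C le_rfl).exists_neg
    have hw' : IsAddUnit w := IsAddUnit.of_add_eq_zero C.sum (by rw [add_comm, hw])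
    refine ⟨u + w, hu.add hw', ?_⟩
    calc q + Q.sum + (u + w) + C.sum = q + Q.sum + u + (C.sum + w) := by abel
      _ = a + e + u := by rw [hw, add_zero, he]
      _ = u + a + e := by abel
      _ = d + a + e := by rw [hua]
      _ = a + e + d := by abel
      _ = a := by rw [← he, ← hd]
  have hsum : ((q + v) ::ₘ Q + C).sum = a := by
    rw [Multiset.sum_add, Multiset.sum_cons, ← hva]
    abel
  refine ⟨(q + v) ::ₘ Q + C, fun T' h1 h2 => ?_, hsum, by simp [hC, add_right_comm]⟩
  rw [hsum] at h2
  obtain ⟨A, hA, C', hC', rfl⟩ := exists_eq_add_of_le_add h1.le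
  rw [Multiset.sum_add] at h2
  -- Units do not affect membership in H_a, so minimality of Q forces all of its terms to be
  -- present. Only units from C can be missing, and these would fix a.
  rcases le_cons_cases hA with hA | ⟨U, hU, rfl⟩
  · exact hmin A (hA.trans_lt (Multiset.lt_cons_self _ _))
      (mem_hClass_of_add_isAddUnit (hCle C' hC') h2)
  · rw [Multiset.sum_cons] at h2
    obtain rfl : U = Q := by
      by_contra hne
      refine hmin (q ::ₘ U) (Multiset.cons_lt_cons_iff.2 (lt_of_le_of_ne hU hne))
        (mem_hClass_of_add_isAddUnit (hv.add (hCle C' hC')) ?_)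
      rw [Multiset.sum_cons, ← h2]
      abel
    obtain ⟨D, rfl⟩ := Multiset.le_iff_exists_add.1 hC'
    refine hz D (Multiset.le_add_left _ _) (by rintro rfl; simp at h1) ?_
    rw [Multiset.sum_add] at hva
    conv_rhs => rw [← hva]
    conv_lhs => rw [← h2]
    abel

end AppendUnits

/-! ### Finite principal ideal rings -/

section Ring

variable {R : Type*} [CommRing R]

theorem exists_pow_mul_pow_eq_self {N : Type*} [Monoid N] [Finite N] (c : N) :
    ∃ k : ℕ, 0 < k ∧ c ^ k * c ^ k = c ^ k := by
  obtain ⟨i, j, hne, hij⟩ := Finite.exists_ne_map_eq_of_infinite (fun i : ℕ => c ^ i)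
  wlog hlt : i < j generalizing i j
  · exact this j i hne.symm hij.symm (by omega)
  obtain ⟨p, rfl⟩ := Nat.exists_eq_add_of_lt hlt
  have h1 : ∀ t s : ℕ, c ^ (i + s + (p + 1) * t) = c ^ (i + s) := by
    intro t s
    induction t with
    | zero => simp
    | succ t ih =>
      rw [← ih, show i + s + (p + 1) * (t + 1) = (i + p + 1) + (s + (p + 1) * t) by ring, pow_add,
        ← hij, ← pow_add]
      congr 1
      ring
  refine ⟨(p + 1) * (i + 1), by positivity, ?_⟩
  rw [← pow_add]
  have := h1 (i + 1) (p * i + p + 1)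
  rwa [show i + (p * i + p + 1) = (p + 1) * (i + 1) by ring] at this

/-- Some power e of c is idempotent and satisfies e b = b. Since c is invertible on eR, the element
equal to c on eR and to 1 on (1 - e)R is a unit with the same effect on b. -/
theorem exists_isUnit_mul_eq [Finite R] {b c d : R} (h : b = c * b * d) :
    ∃ u : R, IsUnit u ∧ u * b = c * b := by
  obtain ⟨k, hk, he⟩ := exists_pow_mul_pow_eq_self c
  have hpow : ∀ n : ℕ, b = c ^ n * b * d ^ n := by
    intro n
    induction n with
    | zero => simp
    | succ n ih => linear_combination h + c * d * ih
  obtain ⟨k, rfl⟩ := Nat.exists_eq_succ_of_ne_zero hk.ne'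
  have hb := hpow (k + 1)
  generalize d ^ (k + 1) = d' at hb
  rw [Nat.succ_eq_add_one, pow_succ] at he
  rw [pow_succ] at hb
  generalize c ^ k = c' at hb he
  have heb : c' * c * b = b := by linear_combination (c' * c - 1) * hb + b * d' * he
  refine ⟨c * (c' * c) + (1 - c' * c), ?_, ?_⟩
  · refine IsUnit.of_mul_eq_one (c' * (c' * c) + (1 - c' * c)) ?_
    linear_combination (c' * c - c - c' + 2) * he
  · linear_combination (c - 1) * heb

/-- Multiplication by c gives an exact sequence R/(q) → R/(cq) → R/(c) → 0. The first map need not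
be injective, so only its range enters. -/
theorem length_quotient_span_mul_le (c q : R) :
    Module.length R (R ⧸ Ideal.span {c * q}) ≤
      Module.length R (R ⧸ Ideal.span {q}) + Module.length R (R ⧸ Ideal.span {c}) := by
  let f : (R ⧸ Ideal.span {q}) →ₗ[R] (R ⧸ Ideal.span {c * q}) :=
    Submodule.mapQ _ _ (LinearMap.mulLeft R c) <| by
      intro x hx
      obtain ⟨y, rfl⟩ := Ideal.mem_span_singleton'.1 hx
      exact Ideal.mem_span_singleton'.2 ⟨y, by rw [LinearMap.mulLeft_apply]; ring⟩
  let g : (R ⧸ Ideal.span {c * q}) →ₗ[R] (R ⧸ Ideal.span {c}) :=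
    Submodule.mapQ _ _ LinearMap.id <| by
      intro x hx
      obtain ⟨y, rfl⟩ := Ideal.mem_span_singleton'.1 hx
      exact Ideal.mem_span_singleton'.2 ⟨y * q, by ring⟩
  have hg : Function.Surjective g := by
    intro x
    obtain ⟨x, rfl⟩ := Submodule.mkQ_surjective _ x
    exact ⟨Submodule.mkQ _ x, rfl⟩
  have hex : Function.Exact f.range.subtype g := by
    intro x
    obtain ⟨x, rfl⟩ := Submodule.mkQ_surjective _ x
    rw [Submodule.coe_subtype, Subtype.range_coe]
    constructor
    · intro h
      have h' : x ∈ Ideal.span {c} := (Submodule.Quotient.mk_eq_zero _).1 h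
      obtain ⟨y, rfl⟩ := Ideal.mem_span_singleton'.1 h'
      exact ⟨Submodule.mkQ _ y, by rw [mul_comm y]; rfl⟩
    · rintro ⟨y, hy⟩
      obtain ⟨y, rfl⟩ := Submodule.mkQ_surjective _ y
      rw [← hy]
      refine (Submodule.Quotient.mk_eq_zero _).2 ?_
      exact Ideal.mem_span_singleton'.2 ⟨y, mul_comm _ _⟩
  rw [Module.length_eq_add_of_exact f.range.subtype g (Submodule.subtype_injective _) hg hex]
  gcongr
  exact Module.length_le_of_surjective f.rangeRestrict f.surjective_rangeRestrict

theorem length_quotient_span_prod_le {Q : Multiset R}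
    (hQ : ∀ q ∈ Q, (Ideal.span {q}).IsMaximal) :
    Module.length R (R ⧸ Ideal.span {Q.prod}) ≤ Q.card := by
  induction Q using Multiset.induction with
  | empty =>
    rw [Multiset.prod_zero, Ideal.span_singleton_one]
    have : Subsingleton (R ⧸ (⊤ : Ideal R)) := Ideal.Quotient.subsingleton_iff.2 rfl
    rw [Module.length_eq_zero]
    exact zero_le
  | cons q Q ih =>
    rw [Multiset.prod_cons, mul_comm, Multiset.card_cons, Nat.cast_succ, add_comm]
    refine (length_quotient_span_mul_le _ _).trans (add_le_add ?_ (ih fun x hx => hQ x ?_))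
    · have : IsSimpleModule R (R ⧸ Ideal.span {q}) :=
        isSimpleModule_iff_isCoatom.2 (hQ q (Multiset.mem_cons_self _ _)).out
      rw [Module.length_eq_one]
    · exact Multiset.mem_cons_of_mem hx

/-- In an Artinian principal ideal ring, every principal ideal is a product of principal maximal
ideals. -/
theorem exists_span_prod_eq [IsArtinianRing R] [IsPrincipalIdealRing R] (b : R) :
    ∃ Q : Multiset R, (∀ q ∈ Q, (Ideal.span {q}).IsMaximal) ∧
      Ideal.span {Q.prod} = Ideal.span {b} := by
  generalize hI : Ideal.span {b} = I
  induction I using WellFoundedGT.induction generalizing b with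
  | ind I ih =>
    subst hI
    by_cases htop : Ideal.span {b} = ⊤
    · exact ⟨0, by simp, by simp [htop]⟩
    -- With J = (b₁) minimal above (b), the quotient J/(b) is simple, so the colon ideal (b) : b₁ is
    -- maximal. Its generator q satisfies (q b₁) = (b), and the induction continues with b₁.
    obtain ⟨J, hJ, hmin⟩ := WellFounded.has_min (wellFounded_lt (α := Ideal R))
      {J | Ideal.span {b} < J} ⟨⊤, lt_top_iff_ne_top.2 htop⟩
    obtain ⟨b₁, rfl⟩ := (IsPrincipalIdealRing.principal J).principal
    change Ideal.span {b} < Ideal.span {b₁} at hJ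
    obtain ⟨q, hq⟩ := (IsPrincipalIdealRing.principal
      (Submodule.comap (LinearMap.mulRight R b₁) (Ideal.span {b}))).principal
    change _ = Ideal.span {q} at hq
    have hmem : ∀ x, x ∈ Ideal.span {q} ↔ x * b₁ ∈ Ideal.span {b} := by
      intro x
      rw [← hq]
      rfl
    have hmax : (Ideal.span {q}).IsMaximal := by
      rw [Ideal.isMaximal_iff]
      refine ⟨fun h1 => ?_, fun J x hJq hx hxJ => ?_⟩
      · have := (hmem 1).1 h1
        rw [one_mul] at this
        exact hJ.not_ge ((Ideal.span_singleton_le_iff_mem _).2 this)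
      · rw [hmem] at hx
        have hle : Ideal.span {b₁} ≤ Ideal.span {b} ⊔ Ideal.span {x * b₁} := by
          have h1 : Ideal.span {b} < Ideal.span {b} ⊔ Ideal.span {x * b₁} :=
            lt_of_le_of_ne le_sup_left fun h => hx <| by
              rw [h]
              exact Ideal.mem_sup_right (Ideal.mem_span_singleton_self _)
          have h2 : Ideal.span {b} ⊔ Ideal.span {x * b₁} ≤ Ideal.span {b₁} :=
            sup_le hJ.le ((Ideal.span_singleton_le_iff_mem _).2
              (Ideal.mem_span_singleton'.2 ⟨x, rfl⟩))
          by_contra h3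
          exact hmin _ h1 (lt_of_le_not_ge h2 h3)
        obtain ⟨y, hy, z, hz, hyz⟩ := Submodule.mem_sup.1
          (hle (Ideal.mem_span_singleton_self b₁))
        obtain ⟨w, rfl⟩ := Ideal.mem_span_singleton'.1 hz
        have h1 : 1 - w * x ∈ Ideal.span {q} := by
          rw [hmem, show (1 - w * x) * b₁ = y by linear_combination -hyz]
          exact hy
        have := J.add_mem (hJq h1) (J.mul_mem_left w hxJ)
        rwa [sub_add_cancel] at this
    obtain ⟨Q, hQ, hQs⟩ := ih _ hJ b₁ rfl
    refine ⟨q ::ₘ Q, ?_, ?_⟩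
    · intro x hx
      rcases Multiset.mem_cons.1 hx with rfl | hx
      · exact hmax
      · exact hQ x hx
    · rw [Multiset.prod_cons, ← Ideal.span_singleton_mul_span_singleton, hQs,
        Ideal.span_singleton_mul_span_singleton]
      refine le_antisymm ?_ ?_
      · rw [Ideal.span_singleton_le_iff_mem, ← hmem]
        exact Ideal.mem_span_singleton_self q
      · obtain ⟨x, hx⟩ := Ideal.mem_span_singleton'.1 (hJ.le (Ideal.mem_span_singleton_self b))
        have : x ∈ Ideal.span {q} := by
          rw [hmem, hx]
          exact Ideal.mem_span_singleton_self b
        obtain ⟨y, rfl⟩ := Ideal.mem_span_singleton'.1 this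
        rw [Ideal.span_singleton_le_iff_mem]
        exact Ideal.mem_span_singleton'.2 ⟨y, by rw [← hx, mul_assoc]⟩

/-- The multiplicative monoid of `R`, written additively, is its own `S⁰`. -/
def ringIncl (x : R) : AdjoinZero (Additive R) := incl (Additive.ofMul x)

theorem ringIncl_mul (x y : R) : ringIncl (x * y) = ringIncl x + ringIncl y := rfl

theorem ringIncl_one : ringIncl (1 : R) = 0 :=
  (incl_eq_zero_iff _).2 fun s => zero_add s

theorem ringIncl_injective : Function.Injective (ringIncl (R := R)) :=
  fun _ _ h => Additive.ofMul.injective (incl_injective h)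

theorem ringIncl_surjective : Function.Surjective (ringIncl (R := R)) := by
  intro x
  rcases eq_zero_or_incl x with rfl | ⟨s, rfl⟩
  · exact ⟨1, ringIncl_one⟩
  · exact ⟨s.toMul, rfl⟩

theorem sum_map_ringIncl (Q : Multiset R) : (Q.map ringIncl).sum = ringIncl Q.prod := by
  induction Q using Multiset.induction with
  | empty => exact ringIncl_one.symm
  | cons q Q ih => rw [Multiset.map_cons, Multiset.sum_cons, ih, Multiset.prod_cons, ringIncl_mul]

theorem mem_principalIdeal_ringIncl {x y : R} :
    ringIncl y ∈ principalIdeal (ringIncl x) ↔ y ∈ Ideal.span {x} := by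
  rw [Ideal.mem_span_singleton]
  constructor
  · rintro ⟨c, hc⟩
    obtain ⟨c, rfl⟩ := ringIncl_surjective c
    exact ⟨c, ringIncl_injective hc⟩
  · rintro ⟨c, rfl⟩
    exact ⟨ringIncl c, rfl⟩

theorem principalIdeal_ringIncl_subset {x y : R} :
    principalIdeal (ringIncl x) ⊆ principalIdeal (ringIncl y) ↔
      Ideal.span {x} ≤ Ideal.span {y} := by
  constructor
  · intro h z hz
    exact mem_principalIdeal_ringIncl.1 (h (mem_principalIdeal_ringIncl.2 hz))
  · intro h z hz
    obtain ⟨z, rfl⟩ := ringIncl_surjective z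
    exact mem_principalIdeal_ringIncl.2 (h (mem_principalIdeal_ringIncl.1 hz))

theorem ringIncl_mem_hClass {x y : R} :
    ringIncl x ∈ hClass (ringIncl y) ↔ Ideal.span {x} = Ideal.span {y} := by
  change principalIdeal (ringIncl x) = principalIdeal (ringIncl y) ↔ _
  rw [Set.Subset.antisymm_iff, principalIdeal_ringIncl_subset, principalIdeal_ringIncl_subset,
    le_antisymm_iff]

/-- A chain of principal ideals is a chain in the lattice of all ideals above (b), whose height is
the length of R/(b). -/
theorem chainLength_ringIncl_le (b : R) :
    chainLength (ringIncl b) ≤ Module.length R (R ⧸ Ideal.span {b}) := by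
  refine iSup₂_le fun l hl => ?_
  obtain ⟨f, h0, hf⟩ := hl
  choose g hg using fun i => ringIncl_surjective (f i)
  let s : LTSeries (Ideal R) :=
    { length := l
      toFun := fun i => Ideal.span {g i}
      step := fun i => by
        have := hf i
        rw [← hg, ← hg] at this
        exact ⟨principalIdeal_ringIncl_subset.1 this.1,
          fun h => this.2 (principalIdeal_ringIncl_subset.2 h)⟩ }
  rw [Module.length_quotient]
  have : s.head = Ideal.span {b} := by
    change Ideal.span {g 0} = _
    rw [ringIncl_injective ((hg 0).trans h0)]
  exact Order.length_le_coheight (p := s) this.ge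

theorem ring_sharp [Finite R] [IsPrincipalIdealRing R] {b : R} (hb : ¬ IsUnit b)
    {a : AdjoinZero (Additive R)} (ha : a = ringIncl b) :
    a ≠ 0 ∧ chainLength a ≠ ⊤ ∧ (hClass a).Finite ∧
      relDavenport a + 1 = chainLength a + davenport (Schutzenberger a) := by
  have : Finite (AdjoinZero (Additive R)) := Finite.of_surjective _ ringIncl_surjective
  subst ha
  refine ⟨?_, chainLength_ne_top _, Set.toFinite _, le_antisymm (relDavenport_add_one_le _) ?_⟩
  · rw [← ringIncl_one, ringIncl_injective.ne_iff]
    rintro rfl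
    exact hb isUnit_one
  classical
  -- A factorization of least cardinality is chosen, so that no proper subsequence of it generates
  -- (b).
  have hex : ∃ n : ℕ, ∃ Q : Multiset R, Q.card = n ∧ (∀ q ∈ Q, (Ideal.span {q}).IsMaximal) ∧
      Ideal.span {Q.prod} = Ideal.span {b} := by
    obtain ⟨Q, h1, h2⟩ := exists_span_prod_eq b
    exact ⟨_, Q, rfl, h1, h2⟩
  obtain ⟨Q, hQn, hQ, hQb⟩ := Nat.find_spec hex
  have hQ0 : Q ≠ 0 := by
    rintro rfl
    rw [Multiset.prod_zero, Ideal.span_singleton_one] at hQb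
    exact hb (Ideal.span_singleton_eq_top.1 hQb.symm)
  have hmin : ∀ U < Q, Ideal.span {U.prod} ≠ Ideal.span {b} := by
    intro U hU h
    refine Nat.find_min hex (m := U.card) (hQn ▸ Multiset.card_lt_card hU)
      ⟨U, rfl, fun q hq => hQ q (Multiset.mem_of_le hU.le hq), h⟩
  have hΨ : chainLength (ringIncl b) ≤ Q.card := by
    refine (chainLength_ringIncl_le b).trans ?_
    rw [← hQb]
    exact length_quotient_span_prod_le hQ
  have hunit : ∀ c ∈ stabMonoid (ringIncl b), ∃ u, IsAddUnit u ∧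
      u + ringIncl b = c + ringIncl b := by
    intro c hc
    obtain ⟨⟨d, hd⟩, -⟩ := mem_hClass_iff.1 (mem_stabMonoid.1 hc)
    obtain ⟨c, rfl⟩ := ringIncl_surjective c
    obtain ⟨d, rfl⟩ := ringIncl_surjective d
    obtain ⟨u, hu, hub⟩ := exists_isUnit_mul_eq (ringIncl_injective hd)
    obtain ⟨v, hv⟩ := hu.exists_right_inv
    refine ⟨ringIncl u, IsAddUnit.of_add_eq_zero (ringIncl v) ?_, congrArg ringIncl hub⟩
    rw [← ringIncl_mul, hv, ringIncl_one]
  obtain ⟨D, hD⟩ := ENat.ne_top_iff_exists.1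
    (davenport_schutzenberger_ne_top (Set.toFinite (hClass (ringIncl b))))
  obtain ⟨n, rfl⟩ : ∃ n, D = n + 1 := by
    have hz : ZeroSumFree (0 : Multiset (Schutzenberger (ringIncl b))) :=
      fun T' h1 h2 => absurd (le_bot_iff.1 h1) h2
    have := hz.card_add_one_le
    rw [← hD] at this
    exact Nat.exists_eq_add_of_le' (by simpa using this)
  obtain ⟨T, hT, hTs, hTc⟩ := exists_irreducibleSeq_of_units hunit (Q := Q.map ringIncl)
    (by simpa using hQ0) (by rw [sum_map_ringIncl, ringIncl_mem_hClass, hQb]) (by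
      intro Q' hQ' h
      obtain ⟨U, hU, rfl⟩ := exists_map_eq_of_lt_map hQ'
      rw [sum_map_ringIncl, ringIncl_mem_hClass] at h
      exact hmin U hU h) (n := n) (by rw [← hD]; exact_mod_cast Nat.lt_succ_self n)
  rw [Multiset.card_map] at hTc
  calc chainLength (ringIncl b) + davenport (Schutzenberger (ringIncl b))
      ≤ Q.card + ((n + 1 : ℕ) : ℕ∞) := by rw [hD]; gcongr
    _ = T.card + 1 := by rw [hTc]; push_cast; ring
    _ ≤ relDavenport (ringIncl b) + 1 := by gcongr; exact le_relDavenport hT hTs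

end Ring

end RelDavenport

/-! ### The bounds and the three sharp families. -/

theorem theorem1p2 :
    -- the bounds
    (∀ (S : Type*) [AddCommSemigroup S] (a : AdjoinZero S), a ≠ 0 → chainLength a ≠ ⊤ →
      ((hClass a).Infinite → relDavenport a = ⊤) ∧
      ((hClass a).Finite →
        relDavenport a ≠ ⊤ ∧
        epsilon a * (davenport (Schutzenberger a) : ℝ≥0∞) ≤ (relDavenport a : ℝ≥0∞) ∧
        relDavenport a + 1 ≤ chainLength a + davenport (Schutzenberger a))) ∧
    -- sharpness of the lower bound when `a + a` and `a` are related, for `n = 2 * h`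
    (∀ (h r : ℕ) (k : Fin r) (a : AdjoinZero (Presented (ChainRel (2 * h) r))),
      0 < h → a = h • incl (gen (ChainRel (2 * h) r) k) →
        a ≠ 0 ∧ chainLength a ≠ ⊤ ∧ (hClass a).Finite ∧ GreenH (a + a) a ∧
        davenport (Schutzenberger a) = (2 * h : ℕ) ∧
        epsilon a * (davenport (Schutzenberger a) : ℝ≥0∞) = (relDavenport a : ℝ≥0∞)) ∧
    -- sharpness of the lower bound when `a + a` and `a` are not related
    (∀ (m : ℕ) (a : AdjoinZero (Presented (TorsorRel m))),
      2 < m → a = incl (gen (TorsorRel m) (.point (m : ZMod m))) →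
        a ≠ 0 ∧ chainLength a ≠ ⊤ ∧ (hClass a).Finite ∧ ¬ GreenH (a + a) a ∧
        davenport (Schutzenberger a) = m ∧
        epsilon a * (davenport (Schutzenberger a) : ℝ≥0∞) = (relDavenport a : ℝ≥0∞)) ∧
    -- sharpness of the upper bound: multiplicative semigroups of finite principal ideal rings
    (∀ (R : Type*) [CommRing R] [Finite R] [IsPrincipalIdealRing R] (b : R)
      (a : AdjoinZero (Additive R)), ¬ IsUnit b → a = incl (Additive.ofMul b) →
        a ≠ 0 ∧ chainLength a ≠ ⊤ ∧ (hClass a).Finite ∧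
        relDavenport a + 1 = chainLength a + davenport (Schutzenberger a)) := by
  refine ⟨fun S _ a h0 hΨ => ⟨fun hinf => ?_, fun hfin => ?_⟩, ?_, ?_, ?_⟩
  · have h := epsilon_mul_davenport_le h0
    -- As ε is not 0, the lower bound is infinite for infinite H_a.
    have hε : epsilon a ≠ 0 := by
      unfold epsilon
      split_ifs <;> simp
    rw [davenport_schutzenberger_eq_top hinf, ENat.toENNReal_top, ENNReal.mul_top hε, top_le_iff,
      ENat.toENNReal_eq_top] at h
    exact h
  · have h := relDavenport_add_one_le a
    refine ⟨fun htop => ?_, epsilon_mul_davenport_le h0, h⟩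
    rw [htop, top_add, top_le_iff, ENat.add_eq_top] at h
    exact h.elim hΨ (davenport_schutzenberger_ne_top hfin)
  · intro h r k a hh ha
    exact chain_sharp k hh ha
  · intro m a hm ha
    exact torsor_sharp (by omega) _ ha
  · intro R _ _ _ b a hb ha
    exact ring_sharp hb ha
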